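/- **Setting.** Let $U$ (users) and $R$ (resources) be finite sets, $k=|R|$, $n=|U|$. For an authorization relation $A\subseteq U\times R$ put $A(r)=\{u:(u,r)\in A\}$ and $A(u)=\{r:(u,r)\in A\}$; $A$ is *complete* if $A(r)\neq\emptyset$ for all $r\in R$. A *weighted user authorization function* is a map $\omega:U\times 2^R\to\mathbb N$ with $\omega(u,T')\le\omega(u,T)$ whenever $T'\subseteq T$, and with $\omega(u,T)=0$ whenever $u$ is authorized for every $r\in T$, where $u$ is authorized for $r$ iff $\omega(u,\{r\})=0$. A weighted universal separation-of-duty (SoD) constraint $c=(r,r',\updownarrow,\forall)$ and a weighted universal binding-of-duty (BoD) constraint $c=(r,r',\leftrightarrow,\forall)$ have the weights $$w_c(A)=f_c\big(|A(r)\cap A(r')|\big)\quad\text{and}\quad w_c(A)=f_c\big(\max\{|A(r)\setminus A(r')|,\,|A(r')\setminus A(r)|\}\big),$$ respectively, where $f_c:\mathbb Z\to\mathbb N$ is non-decreasing and $f_c(z)=0$ iff $z\le 0$. An instance $\mathcal I=(R,U,C,\omega)$ of Valued APEP$\langle \mathsf{BoD}_\forall,\mathsf{SoD}_\forall\rangle$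 consists of $R$, $U$, $\omega$ and a finite family $C$ of such constraints. The weight of $A$ is $w(A)=\sum_{u\in U}\omega(u,A(u))+\sum_{c\in C}w_c(A)$. The task is to find an *optimal solution*: a complete $A$ with $w(A)\le w(A')$ for all complete $A'$. The parameter is $k$. An instance of Valued WSP$(=,\neq)$ consists of a finite set $S$ of steps, a finite set $U$ of users, a weighted user authorization function $\omega$ on $U\times 2^S$, and a finite family of constraints $(s,s',\neq)$ and $(s,s',=)$, each with a positive penalty. The weight of a plan $\pi:S\to U$ is $\sum_{u\in U}\omega(u,\pi^{-1}(u))$ plus the penalties of the violated constraints, where $(s,s',\neq)$ is satisfied iff $\pi(s)\ne\pi(s')$ and $(s,s',=)$ is satisfied iff $\pi(s)=\pi(s')$. An optimal plan is one of minimum weight. **Computational model.** Algorithms are single programs for a random access machine with logarithmic cost (every step is charged according to the bit lengths of the numbers that it handles). The sets $U$ and $R$ are given as $\{0,\dots,n-1\}$ and $\{0,\dots,k-1\}$, each constraint $c$ by its type, its two resources and the table of $f_c(0),\dots,f_c(n)$, and $\omega$ by an oracle that returns $\omega(u,T)$ on the query $(u,T)$, with $T$ given as a bit mask. The size $|\mathcal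 I|$ is $1+n+k+|C|$ plus the bit lengths of all the values $f_c(0),\dots,f_c(n)$, $c\in C$, and of the values $\omega(u,R)=\max_T\omega(u,T)$, $u\in U$ (so the $n2^k$ values of $\omega$ do not count towards $|\mathcal I|$). Time $\mathcal O^*(f(k))$ means time at most $K f(k)|\mathcal I|^{d}$ with absolute constants $K,d$. Running times and outputs are claimed for instances that have a complete authorization relation (that is, $U\ne\emptyset$ or $R=\emptyset$). **Theorem.** 1. Valued APEP$\langle \mathsf{BoD}_\forall,\mathsf{SoD}_\forall\rangle$ is fixed-parameter tractable: for some computable $g:\mathbb N\to\mathbb N$ there is an algorithm that outputs an optimal solution in time $\mathcal O^*(g(k))$. 2. There is an algorithm that outputs an optimal solution of Valued APEP$\langle \mathsf{BoD}_\forall,\mathsf{SoD}_\forall\rangle$ in time $\mathcal O^*(2^{k\log_2 k})$ (where $2^{k\log_2 k}=1$ for $k=0$). 3. Each instance $\mathcal I$ that has a complete authorization relation has an optimal solution $A$ with $|A(r)|=1$ for all $r\in R$. Moreover, each optimal solution $A^*$ of $\mathcal I$ contains an optimal solution $A'\subseteq A^*$ with $|A'(r)|=1$ for all $r\in R$. 4.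 Let $\mathcal I'$ be the Valued WSP$(=,\neq)$ instance with steps $R$, users $U$ and the same $\omega$, which has for each $c\in C$ of the form $(r,r',\updownarrow,\forall)$ the constraint $(r,r',\neq)$, and for each $c\in C$ of the form $(r,r',\leftrightarrow,\forall)$ the constraint $(r,r',=)$, with penalty $f_c(1)$ in both cases. Every plan $\pi:R\to U$ has the same weight in $\mathcal I'$ as the relation $A_\pi=\{(\pi(r),r):r\in R\}$ has in $\mathcal I$; $\pi$ is an optimal plan of $\mathcal I'$ iff $A_\pi$ is an optimal solution of $\mathcal I$; and optimal plans of $\mathcal I'$ and optimal solutions of $\mathcal I$ have equal weights. The users, steps and constraints of $\mathcal I'$ can be computed from $\mathcal I$ in time polynomial in $|\mathcal I|$ (the oracle for $\omega$ is the same). -/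

import Mathlib

namespace APEP

section Problems

variable {U R : Type*}

/-- A weighted user authorization function `ω : U × 2^R → ℕ`. The base authorization relation is
the one that `ω` determines: `u` is authorized for `r` iff `ω u {r} = 0`. -/
structure AuthWeight (U R : Type*) where
  ω : U → Finset R → ℕ
  zero_of_authorized : ∀ u T, (∀ r ∈ T, ω u {r} = 0) → ω u T = 0
  mono : ∀ u T' T, T' ⊆ T → ω u T' ≤ ω u T

/-- Separation of duty or binding of duty. -/
inductive Duty where
  | sod
  | bod

/-- A weighted universal constraint `(r, r', ↕, ∀)` (for `Duty.sod`) or `(r, r', ↔, ∀)`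
(for `Duty.bod`), together with its penalty function `f_c : ℤ → ℕ`. -/
structure UConstraint (R : Type*) where
  duty : Duty
  fst : R
  snd : R
  f : ℤ → ℕ
  f_mono : ∀ z, f z ≤ f (z + 1)
  f_eq_zero_iff : ∀ z, f z = 0 ↔ z ≤ 0

/-- An instance `(R, U, C, ω)` of Valued APEP all of whose constraints are universal BoD or
universal SoD constraints. -/
structure ValuedAPEP (U R : Type*) where
  auth : AuthWeight U R
  m : ℕ
  con : Fin m → UConstraint R

variable [Fintype U] [Fintype R] [DecidableEq U] [DecidableEq R]

/-- `A(r)`: the users that `A` authorizes for `r`. -/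
def usersOf (A : Finset (U × R)) (r : R) : Finset U :=
  Finset.univ.filter fun u => (u, r) ∈ A

/-- `A(u)`: the resources for which `A` authorizes `u`. -/
def resourcesOf (A : Finset (U × R)) (u : U) : Finset R :=
  Finset.univ.filter fun r => (u, r) ∈ A

/-- `A(r) ≠ ∅` for every resource `r`. -/
def Complete (A : Finset (U × R)) : Prop :=
  ∀ r, (usersOf A r).Nonempty

/-- `max {|A(r) \ A(r')|, |A(r') \ A(r)|}`. -/
def maxdiff (A : Finset (U × R)) (r r' : R) : ℕ :=
  max (usersOf A r \ usersOf A r').card (usersOf A r' \ usersOf A r).card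

/-- `w_c(A)`. -/
def UConstraint.weight (c : UConstraint R) (A : Finset (U × R)) : ℕ :=
  match c.duty with
  | Duty.sod => c.f ((usersOf A c.fst ∩ usersOf A c.snd).card : ℤ)
  | Duty.bod => c.f (maxdiff A c.fst c.snd : ℤ)

namespace ValuedAPEP

/-- `w(A) = Ω(A) + w_C(A)`. -/
def weight (I : ValuedAPEP U R) (A : Finset (U × R)) : ℕ :=
  ∑ u, I.auth.ω u (resourcesOf A u) + ∑ c, (I.con c).weight A

/-- A complete authorization relation of minimum weight among the complete ones. -/
def IsOptimalSolution (I : ValuedAPEP U R) (A : Finset (U × R)) : Prop :=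
  Complete A ∧ ∀ A' : Finset (U × R), Complete A' → I.weight A ≤ I.weight A'

end ValuedAPEP

/-- A weighted constraint `(s, s', ≠)` (for `Duty.sod`) or `(s, s', =)` (for `Duty.bod`) of
Valued WSP, whose violation costs `penalty > 0`. -/
structure WSPConstraint (S : Type*) where
  duty : Duty
  fst : S
  snd : S
  penalty : ℕ
  penalty_pos : 0 < penalty

/-- An instance of Valued WSP(=,≠), with set of users `U` and set of steps `S`. -/
structure ValuedWSP (U S : Type*) where
  auth : AuthWeight U S
  m : ℕ
  con : Fin m → WSPConstraint S

/-- The weight of a constraint under the plan `π`. -/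
def WSPConstraint.weight (c : WSPConstraint R) (π : R → U) : ℕ :=
  match c.duty with
  | Duty.sod => if π c.fst ≠ π c.snd then 0 else c.penalty
  | Duty.bod => if π c.fst = π c.snd then 0 else c.penalty

namespace ValuedWSP

/-- The weight of the plan `π`. -/
def weight (J : ValuedWSP U R) (π : R → U) : ℕ :=
  ∑ u, J.auth.ω u (Finset.univ.filter fun s => π s = u) + ∑ c, (J.con c).weight π

/-- A plan of minimum weight. -/
def IsOptimalPlan (J : ValuedWSP U R) (π : R → U) : Prop :=
  ∀ π' : R → U, J.weight π ≤ J.weight π'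

end ValuedWSP

/-- The authorization relation `{(π r, r) | r ∈ R}` of a plan `π`. -/
def graph (π : R → U) : Finset (U × R) :=
  Finset.univ.image fun r => (π r, r)

/-- The Valued WSP(=,≠) instance of a Valued APEP instance: the steps are the resources, the users
and `ω` are unchanged, and each universal constraint becomes the corresponding binary constraint,
with penalty `f_c(1)`. -/
def ValuedAPEP.toWSP (I : ValuedAPEP U R) : ValuedWSP U R where
  auth := I.auth
  m := I.m
  con c :=
    { duty := (I.con c).duty
      fst := (I.con c).fst
      snd := (I.con c).snd
      penalty := (I.con c).f 1
      penalty_pos := Nat.pos_of_ne_zero fun h =>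
        absurd (((I.con c).f_eq_zero_iff 1).1 h) (by norm_num) }

end Problems

/-! ### Random access machines with logarithmic cost

Programs are while programs over finitely many registers and finitely many arrays of natural
numbers, with an oracle `O : ℕ → ℕ → ℕ`. Every step is charged in proportion to the bit lengths
of the numbers it handles (`Nat.size` is the bit length). -/

/-- The memory: registers `var x` and arrays `arr a`, with cells `arr a i`. -/
structure Mem where
  var : ℕ → ℕ
  arr : ℕ → ℕ → ℕ

/-- The memory after storing `v` in register `x`. -/
def Mem.setVar (M : Mem) (x v : ℕ) : Mem where
  var := Function.update M.var x v
  arr := M.arr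

/-- The memory after storing `v` in cell `i` of array `a`. -/
def Mem.setCell (M : Mem) (a i v : ℕ) : Mem where
  var := M.var
  arr := Function.update M.arr a (Function.update (M.arr a) i v)

/-- Arithmetic operations and comparisons. -/
inductive Op where
  | add | sub | mul | div | mod | eq | lt

/-- The value of an operation; comparisons return `1` or `0`, and subtraction truncates at `0`. -/
def Op.apply : Op → ℕ → ℕ → ℕ
  | add, a, b => a + b
  | sub, a, b => a - b
  | mul, a, b => a * b
  | div, a, b => a / b
  | mod, a, b => a % b
  | eq, a, b => if a = b then 1 else 0
  | lt, a, b => if a < b then 1 else 0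

/-- Expressions: constants, registers, array cells, operations, oracle queries. -/
inductive Expr where
  | const (c : ℕ)
  | var (x : ℕ)
  | cell (a : ℕ) (i : Expr)
  | op (o : Op) (e₁ e₂ : Expr)
  | query (e₁ e₂ : Expr)

/-- The value of an expression. -/
def Expr.eval (O : ℕ → ℕ → ℕ) (M : Mem) : Expr → ℕ
  | const c => c
  | var x => M.var x
  | cell a i => M.arr a (i.eval O M)
  | op o e₁ e₂ => o.apply (e₁.eval O M) (e₂.eval O M)
  | query e₁ e₂ => O (e₁.eval O M) (e₂.eval O M)

/-- The time for evaluating an expression. Each node costs one plus the bit length of its value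
(those of its operands are charged at the operands); an operation moreover costs the product of
the bit lengths of its operands, each increased by one, as for schoolbook arithmetic. -/
def Expr.cost (O : ℕ → ℕ → ℕ) (M : Mem) : Expr → ℕ
  | const c => 1 + c.size
  | var x => 1 + (M.var x).size
  | cell a i => i.cost O M + (1 + (M.arr a (i.eval O M)).size)
  | op o e₁ e₂ => e₁.cost O M + e₂.cost O M
      + ((e₁.eval O M).size + 1) * ((e₂.eval O M).size + 1)
      + (1 + (o.apply (e₁.eval O M) (e₂.eval O M)).size)
  | query e₁ e₂ => e₁.cost O M + e₂.cost O M + (1 + (O (e₁.eval O M) (e₂.eval O M)).size)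

/-- Programs. -/
inductive Cmd where
  | skip
  | assign (x : ℕ) (e : Expr)
  | write (a : ℕ) (i e : Expr)
  | seq (c₁ c₂ : Cmd)
  | ite (e : Expr) (c₁ c₂ : Cmd)
  | while (e : Expr) (c : Cmd)

/-- `Exec O c M M' t`: started in memory `M`, the program `c` halts in memory `M'` after time `t`.
A condition counts as true iff its value is not `0`. -/
inductive Exec (O : ℕ → ℕ → ℕ) : Cmd → Mem → Mem → ℕ → Prop where
  | skip (M : Mem) : Exec O Cmd.skip M M 1
  | assign (x : ℕ) (e : Expr) (M : Mem) :
      Exec O (Cmd.assign x e) M (M.setVar x (e.eval O M)) (1 + e.cost O M)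
  | write (a : ℕ) (i e : Expr) (M : Mem) :
      Exec O (Cmd.write a i e) M (M.setCell a (i.eval O M) (e.eval O M))
        (1 + i.cost O M + e.cost O M)
  | seq {c₁ c₂ : Cmd} {M₁ M₂ M₃ : Mem} {t₁ t₂ : ℕ} :
      Exec O c₁ M₁ M₂ t₁ → Exec O c₂ M₂ M₃ t₂ → Exec O (Cmd.seq c₁ c₂) M₁ M₃ (t₁ + t₂)
  | iteTrue {e : Expr} {c₁ c₂ : Cmd} {M M' : Mem} {t : ℕ} :
      e.eval O M ≠ 0 → Exec O c₁ M M' t → Exec O (Cmd.ite e c₁ c₂) M M' (1 + e.cost O M + t)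
  | iteFalse {e : Expr} {c₁ c₂ : Cmd} {M M' : Mem} {t : ℕ} :
      e.eval O M = 0 → Exec O c₂ M M' t → Exec O (Cmd.ite e c₁ c₂) M M' (1 + e.cost O M + t)
  | whileTrue {e : Expr} {c : Cmd} {M₁ M₂ M₃ : Mem} {t₁ t₂ : ℕ} :
      e.eval O M₁ ≠ 0 → Exec O c M₁ M₂ t₁ → Exec O (Cmd.while e c) M₂ M₃ t₂ →
      Exec O (Cmd.while e c) M₁ M₃ (1 + e.cost O M₁ + t₁ + t₂)
  | whileFalse {e : Expr} {c : Cmd} {M : Mem} :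
      e.eval O M = 0 → Exec O (Cmd.while e c) M M (1 + e.cost O M)

/-! ### Inputs, outputs and running times -/

/-- The oracle for `ω`: the query `(u, t)` returns `ω(u, T)`, where `T` is the set of all `r` such
that bit `r` of `t` is `1`. -/
def AuthWeight.oracle {n k : ℕ} (W : AuthWeight (Fin n) (Fin k)) (u t : ℕ) : ℕ :=
  if h : u < n then W.ω ⟨u, h⟩ (Finset.univ.filter fun r : Fin k => t.testBit r = true) else 0

/-- The code of a constraint type. -/
def Duty.code : Duty → ℕ
  | Duty.sod => 0
  | Duty.bod => 1

namespace ValuedAPEP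

variable {n k : ℕ}

/-- The input memory of an instance with users `0, …, n - 1` and resources `0, …, k - 1`. Registers
`0, 1, 2` hold `k`, `n` and the number `m` of constraints. For each constraint `c < m`, arrays
`0, 1, 2` hold its type and its two resources at position `c`, and array `3` holds the values
`f_c(0), …, f_c(n)` at positions `c (n + 1), …, c (n + 1) + n`. All else is `0`. -/
def encode (I : ValuedAPEP (Fin n) (Fin k)) : Mem where
  var
    | 0 => k
    | 1 => n
    | 2 => I.m
    | _ => 0
  arr
    | 0 => fun i => if h : i < I.m then (I.con ⟨i, h⟩).duty.code else 0
    | 1 => fun i => if h : i < I.m then (I.con ⟨i, h⟩).fst else 0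
    | 2 => fun i => if h : i < I.m then (I.con ⟨i, h⟩).snd else 0
    | 3 => fun i => if h : i / (n + 1) < I.m then
        (I.con ⟨i / (n + 1), h⟩).f ((i % (n + 1) : ℕ) : ℤ) else 0
    | _ => fun _ => 0

/-- The size of an instance: one plus the numbers of users, of resources and of constraints, the
bit lengths of the tables of the functions `f_c`, and the bit lengths of the largest values
`ω(u, R)` of `ω(u, ·)`. -/
def size (I : ValuedAPEP (Fin n) (Fin k)) : ℕ :=
  1 + n + k + I.m + (∑ c, ∑ z : Fin (n + 1), ((I.con c).f ((z : ℕ) : ℤ)).size)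
    + ∑ u, (I.auth.ω u Finset.univ).size

end ValuedAPEP

/-- The authorization relation whose indicator function is stored row by row in an array. -/
def readRelation (n k : ℕ) (a : ℕ → ℕ) : Finset (Fin n × Fin k) :=
  Finset.univ.filter fun p => a ((p.1 : ℕ) * k + p.2) = 1

/-- `M` holds the users, the steps and the constraints of a Valued WSP(=,≠) instance: registers
`0, 1, 2` hold the numbers of steps, of users and of constraints; arrays `4, 5, 6, 7` hold the
types, the two steps and the penalties of the constraints. -/
def ValuedWSP.StoredIn {n k : ℕ} (J : ValuedWSP (Fin n) (Fin k)) (M : Mem) : Prop :=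
  M.var 0 = k ∧ M.var 1 = n ∧ M.var 2 = J.m ∧
    ∀ c : Fin J.m, M.arr 4 c = (J.con c).duty.code ∧ M.arr 5 c = (J.con c).fst ∧
      M.arr 6 c = (J.con c).snd ∧ M.arr 7 c = (J.con c).penalty

/-- A single program halts on each instance `I` that has a complete authorization relation, within
time `O(f(k) |I|^c)` for a constant `c`, in a memory with property `Goal I`; here `k` is the number
of resources. -/
def AchievableInTime (Goal : ∀ {n k : ℕ}, ValuedAPEP (Fin n) (Fin k) → Mem → Prop)
    (f : ℕ → ℝ) : Prop :=
  ∃ (P : Cmd) (K c : ℕ), ∀ (n k : ℕ) (I : ValuedAPEP (Fin n) (Fin k)),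
    (∃ A : Finset (Fin n × Fin k), Complete A) →
      ∃ (M : Mem) (t : ℕ), Exec I.auth.oracle P I.encode M t ∧ Goal I M ∧
        (t : ℝ) ≤ K * f k * (I.size : ℝ) ^ c

/-- Valued APEP with only universal BoD and SoD constraints can be solved in time `O*(f(k))`: the
program leaves an optimal solution in array `4`. -/
def SolvableInTime (f : ℕ → ℝ) : Prop :=
  AchievableInTime (fun {n k} I M => I.IsOptimalSolution (readRelation n k (M.arr 4))) f

/-- Valued APEP with only universal BoD and SoD constraints, parameterized by the number of
resources, is fixed-parameter tractable. -/
def IsFPT : Prop :=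
  ∃ g : ℕ → ℕ, Computable g ∧ SolvableInTime fun k => (g k : ℝ)

end APEP

namespace APEP

/-! ### A program logic for the machine -/

/-! A complete `A` can be thinned to a plan `π` without gaining weight: choose `π r ∈ A(r)` as a
function of the set `A(r)` alone. Users lose resources, so `ω` does not grow. If `π r = π r'`, this
user lies in `A(r) ∩ A(r')`; if `π r ≠ π r'`, then `A(r) ≠ A(r')`. So any constraint that the plan
violates, at cost `f_c(1)`, costs at least `f_c(1)` under `A`. This is `exists_plan_le`; it gives
the optimal solutions with one user per resource and the equivalence with Valued WSP.

The weight of a plan splits into a sum over users of a cost of the set `π⁻¹(u)`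
(`weight_graph_eq_sum`): a violated SoD constraint is charged to the user who performs both steps, a
violated BoD constraint to the user of its first step. An optimal plan is thus a cheapest
distribution of the resources among the users, found by the recurrence `D (u+1) T = min (D u (T \ S)
+ cost (u+1) S)` over `S ⊆ T`. Backtracking through the minimizers yields the plan
(`isOptimalSolution_of_isTable`).

The program tries all pairs of masks `(T, S)` for each user, about `4^k` pairs, and `4^k ≤ 256 k^k`.
So one program proves both running time claims, with `g k = k^k`. All stored numbers have at most
`3|I|` bits, which keeps the logarithmic cost of a step polynomial. The predicate `Run` carries
correctness, time and bit lengths together (`run_solveCmd`). -/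

theorem Op.size_apply_le (o : Op) (a b : ℕ) : (o.apply a b).size ≤ a.size + b.size + 1 := by
  have hle : ∀ c, c ≤ a → c.size ≤ a.size + b.size + 1 := fun c hc =>
    (Nat.size_le_size hc).trans (by omega)
  have hone : ∀ c, c ≤ 1 → c.size ≤ a.size + b.size + 1 := fun c hc =>
    (Nat.size_le_size hc).trans (by simp)
  have ha := Nat.lt_size_self a
  have hb := Nat.lt_size_self b
  cases o with
  | add =>
    refine Nat.size_le.2 ?_
    have h1 : 2 ^ a.size ≤ 2 ^ (a.size + b.size) := Nat.pow_le_pow_right (by norm_num) (by omega)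
    have h2 : 2 ^ b.size ≤ 2 ^ (a.size + b.size) := Nat.pow_le_pow_right (by norm_num) (by omega)
    simp only [Op.apply, pow_succ]
    omega
  | sub => exact hle _ (Nat.sub_le a b)
  | mul =>
    have h : a * b < 2 ^ (a.size + b.size) := by
      rw [pow_add]
      exact Nat.mul_lt_mul'' ha hb
    exact (Nat.size_le.2 h).trans (Nat.le_succ _)
  | div => exact hle _ (Nat.div_le_self a b)
  | mod => exact hle _ (Nat.mod_le a b)
  | eq => exact hone _ (by simp only [Op.apply]; split_ifs <;> simp)
  | lt => exact hone _ (by simp only [Op.apply]; split_ifs <;> simp)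

/-- A factor by which an expression may lengthen the numbers in memory. -/
def Expr.growth : Expr → ℕ
  | const c => c.size + 1
  | var _ => 1
  | cell _ _ => 1
  | op _ e₁ e₂ => e₁.growth + e₂.growth
  | query _ _ => 1

/-- The cost of an expression, in units that are quadratic in the lengths of the numbers. -/
def Expr.units : Expr → ℕ
  | const c => 1 + c.size
  | var _ => 1
  | cell _ i => i.units + 1
  | op _ e₁ e₂ => e₁.units + e₂.units + e₁.growth * e₂.growth + (e₁.growth + e₂.growth)
  | query e₁ e₂ => e₁.units + e₂.units + 1

/-- All numbers in memory have at most `B` bits. -/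
def Mem.Bounded (B : ℕ) (M : Mem) : Prop :=
  (∀ x, M.var x < 2 ^ B) ∧ ∀ a i, M.arr a i < 2 ^ B

/-- Bounding `size + 1` instead of `size` absorbs the extra bit that an operation may produce, so
that growth factors simply add. Intermediate values may exceed `B` bits; only stored values must
not. -/
theorem Expr.size_eval_lt {O : ℕ → ℕ → ℕ} {B : ℕ} {M : Mem} (hO : ∀ a b, O a b < 2 ^ B)
    (hM : M.Bounded B) (e : Expr) : (e.eval O M).size + 1 ≤ e.growth * (B + 1) := by
  induction e with
  | const c => simp only [eval, growth]; nlinarith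
  | var x => simpa [eval, growth] using Nat.size_le.2 (hM.1 x)
  | cell a i => simpa [eval, growth] using Nat.size_le.2 (hM.2 a _)
  | op o e₁ e₂ h₁ h₂ =>
    have := o.size_apply_le (e₁.eval O M) (e₂.eval O M)
    simp only [eval, growth, add_mul]
    omega
  | query e₁ e₂ => simpa [eval, growth] using Nat.size_le.2 (hO _ _)

theorem Expr.cost_le {O : ℕ → ℕ → ℕ} {B : ℕ} {M : Mem} (hO : ∀ a b, O a b < 2 ^ B)
    (hM : M.Bounded B) (e : Expr) : e.cost O M ≤ e.units * (B + 1) ^ 2 := by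
  have hsq : B + 1 ≤ (B + 1) ^ 2 := Nat.le_self_pow (by norm_num) _
  induction e with
  | const c => simp only [cost, units]; nlinarith
  | var x =>
    have := Nat.size_le.2 (hM.1 x)
    simp only [cost, units]; omega
  | cell a i h =>
    have := Nat.size_le.2 (hM.2 a (i.eval O M))
    simp only [cost, units, add_mul]; omega
  | op o e₁ e₂ h₁ h₂ =>
    have s₁ := e₁.size_eval_lt hO hM
    have s₂ := e₂.size_eval_lt hO hM
    have s := o.size_apply_le (e₁.eval O M) (e₂.eval O M)
    have hm := Nat.mul_le_mul s₁ s₂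
    have hg : (e₁.growth + e₂.growth) * (B + 1) ≤ (e₁.growth + e₂.growth) * (B + 1) ^ 2 :=
      Nat.mul_le_mul_left _ hsq
    have he : e₁.growth * (B + 1) * (e₂.growth * (B + 1)) =
      e₁.growth * e₂.growth * (B + 1) ^ 2 := by ring
    have hu : (Expr.op o e₁ e₂).units * (B + 1) ^ 2 = e₁.units * (B + 1) ^ 2 +
        e₂.units * (B + 1) ^ 2 + e₁.growth * e₂.growth * (B + 1) ^ 2 +
        (e₁.growth + e₂.growth) * (B + 1) ^ 2 := by simp only [units]; ring
    rw [hu, ← he]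
    rw [add_mul] at hg
    simp only [cost]
    omega
  | query e₁ e₂ h₁ h₂ =>
    have := Nat.size_le.2 (hO (e₁.eval O M) (e₂.eval O M))
    simp only [cost, units, add_mul]; omega

/-- Whether a program may change register `x`. -/
def Cmd.setsVar : Cmd → ℕ → Bool
  | skip, _ => false
  | assign y _, x => x == y
  | write _ _ _, _ => false
  | seq c₁ c₂, x => c₁.setsVar x || c₂.setsVar x
  | ite _ c₁ c₂, x => c₁.setsVar x || c₂.setsVar x
  | Cmd.while _ c, x => c.setsVar x

/-- Whether a program may change array `a`. -/
def Cmd.setsArr : Cmd → ℕ → Bool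
  | skip, _ => false
  | assign _ _, _ => false
  | write b _ _, a => a == b
  | seq c₁ c₂, a => c₁.setsArr a || c₂.setsArr a
  | ite _ c₁ c₂, a => c₁.setsArr a || c₂.setsArr a
  | Cmd.while _ c, a => c.setsArr a

/-- Two memories agree outside of what the program `c` may change. -/
def Agree (c : Cmd) (M M' : Mem) : Prop :=
  (∀ x, c.setsVar x = false → M'.var x = M.var x) ∧
    ∀ a, c.setsArr a = false → M'.arr a = M.arr a

theorem Agree.refl (c : Cmd) (M : Mem) : Agree c M M :=
  ⟨fun _ _ => rfl, fun _ _ => rfl⟩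

theorem Agree.trans {c : Cmd} {M₁ M₂ M₃ : Mem} (h : Agree c M₁ M₂) (h' : Agree c M₂ M₃) :
    Agree c M₁ M₃ :=
  ⟨fun x hx => (h'.1 x hx).trans (h.1 x hx), fun a ha => (h'.2 a ha).trans (h.2 a ha)⟩

theorem Agree.mono {c c' : Cmd} {M M' : Mem} (h : Agree c M M')
    (hx : ∀ x, c'.setsVar x = false → c.setsVar x = false)
    (ha : ∀ a, c'.setsArr a = false → c.setsArr a = false) : Agree c' M M' :=
  ⟨fun x h' => h.1 x (hx x h'), fun a h' => h.2 a (ha a h')⟩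

/-- The frame rule. What a program may change is computed from its text, so for a concrete program
the side conditions are closed by `rfl`. -/
theorem Exec.agree {O : ℕ → ℕ → ℕ} {c : Cmd} {M M' : Mem} {t : ℕ} (h : Exec O c M M' t) :
    Agree c M M' := by
  induction h with
  | skip M => exact Agree.refl _ _
  | assign x e M =>
    refine ⟨fun y hy => ?_, fun _ _ => rfl⟩
    simp only [Cmd.setsVar, beq_eq_false_iff_ne] at hy
    simp [Mem.setVar, Function.update_of_ne hy]
  | write a i e M =>
    refine ⟨fun _ _ => rfl, fun b hb => ?_⟩
    simp only [Cmd.setsArr, beq_eq_false_iff_ne] at hb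
    simp [Mem.setCell, Function.update_of_ne hb]
  | seq _ _ h₁ h₂ =>
    exact (h₁.mono (by simp +contextual [Cmd.setsVar]) (by simp +contextual [Cmd.setsArr])).trans
      (h₂.mono (by simp +contextual [Cmd.setsVar]) (by simp +contextual [Cmd.setsArr]))
  | iteTrue _ _ h =>
    exact h.mono (by simp +contextual [Cmd.setsVar]) (by simp +contextual [Cmd.setsArr])
  | iteFalse _ _ h =>
    exact h.mono (by simp +contextual [Cmd.setsVar]) (by simp +contextual [Cmd.setsArr])
  | whileTrue _ _ _ h₁ h₂ =>
    exact (h₁.mono (by simp +contextual [Cmd.setsVar])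
      (by simp +contextual [Cmd.setsArr])).trans h₂
  | whileFalse _ => exact Agree.refl _ _

/-- If the oracle's answers and the contents of `M` have at most `B` bits, then the program `c`,
started in `M`, halts within `N` units of time in a memory with property `Q`, and no number with
more than `B` bits is left in memory. -/
def Run (O : ℕ → ℕ → ℕ) (B : ℕ) (c : Cmd) (M : Mem) (N : ℕ) (Q : Mem → Prop) : Prop :=
  (∀ a b, O a b < 2 ^ B) → M.Bounded B →
    ∃ M' t, Exec O c M M' t ∧ M'.Bounded B ∧ t ≤ N * (B + 1) ^ 2 ∧ Q M'

namespace Run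

variable {O : ℕ → ℕ → ℕ} {B : ℕ} {c c₁ c₂ : Cmd} {M : Mem} {N N' N₁ N₂ : ℕ} {Q Q' : Mem → Prop}

/-- The rule of consequence; the weakening step may also use the frame condition and the bound on
the new memory. -/
theorem mono (h : Run O B c M N Q) (hN : N ≤ N')
    (hQ : ∀ M', M'.Bounded B → Agree c M M' → Q M' → Q' M') : Run O B c M N' Q' := by
  intro hO hM
  obtain ⟨M', t, he, hB, ht, hq⟩ := h hO hM
  exact ⟨M', t, he, hB, ht.trans (Nat.mul_le_mul_right _ hN), hQ M' hB he.agree hq⟩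

theorem of_le (h : Run O B c M N Q) (hN : N ≤ N') : Run O B c M N' Q :=
  h.mono hN fun _ _ _ hq => hq

theorem of_bounded (h : M.Bounded B → Run O B c M N Q) : Run O B c M N Q :=
  fun hO hM => h hM hO hM

theorem skip (h : Q M) : Run O B Cmd.skip M 1 Q := fun _ hM =>
  ⟨M, 1, Exec.skip M, hM, by rw [one_mul]; exact Nat.one_le_pow _ _ (by omega), h⟩

theorem one_add_cost_le (hO : ∀ a b, O a b < 2 ^ B) (hM : M.Bounded B) (e : Expr) :
    1 + e.cost O M ≤ (1 + e.units) * (B + 1) ^ 2 := by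
  have := e.cost_le hO hM
  have h1 : 1 ≤ (B + 1) ^ 2 := Nat.one_le_pow _ _ (by omega)
  rw [add_mul]; omega

theorem assign {x : ℕ} {e : Expr} (hv : e.eval O M < 2 ^ B) (h : Q (M.setVar x (e.eval O M))) :
    Run O B (Cmd.assign x e) M (1 + e.units) Q := fun hO hM =>
  ⟨_, _, Exec.assign x e M, ⟨fun y => by
      simp only [Mem.setVar, Function.update_apply]; split_ifs; exacts [hv, hM.1 y], hM.2⟩,
    one_add_cost_le hO hM e, h⟩

theorem write {a : ℕ} {i e : Expr} (hv : e.eval O M < 2 ^ B)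
    (h : Q (M.setCell a (i.eval O M) (e.eval O M))) :
    Run O B (Cmd.write a i e) M (1 + i.units + e.units) Q := fun hO hM =>
  ⟨_, _, Exec.write a i e M, ⟨hM.1, fun b j => by
      simp only [Mem.setCell, Function.update_apply]
      split_ifs
      · simp only [Function.update_apply]; split_ifs; exacts [hv, hM.2 a j]
      · exact hM.2 b j⟩, by
    have := one_add_cost_le hO hM i
    have := e.cost_le hO hM
    rw [add_mul]; omega, h⟩

theorem seq (h : Run O B c₁ M N₁ fun M' => Run O B c₂ M' N₂ Q) :
    Run O B (Cmd.seq c₁ c₂) M (N₁ + N₂) Q := by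
  intro hO hM
  obtain ⟨M₁, t₁, he₁, hB₁, ht₁, h₂⟩ := h hO hM
  obtain ⟨M₂, t₂, he₂, hB₂, ht₂, hq⟩ := h₂ hO hB₁
  exact ⟨M₂, _, Exec.seq he₁ he₂, hB₂, by rw [add_mul]; omega, hq⟩

theorem ite {e : Expr} (h₁ : e.eval O M ≠ 0 → Run O B c₁ M N₁ Q)
    (h₂ : e.eval O M = 0 → Run O B c₂ M N₂ Q) :
    Run O B (Cmd.ite e c₁ c₂) M (1 + e.units + (N₁ + N₂)) Q := by
  intro hO hM
  have hc := one_add_cost_le hO hM e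
  by_cases he : e.eval O M = 0
  · obtain ⟨M', t, hx, hB, ht, hq⟩ := h₂ he hO hM
    exact ⟨M', _, Exec.iteFalse he hx, hB, by rw [add_mul, add_mul N₁]; omega, hq⟩
  · obtain ⟨M', t, hx, hB, ht, hq⟩ := h₁ he hO hM
    exact ⟨M', _, Exec.iteTrue he hx, hB, by rw [add_mul, add_mul N₁]; omega, hq⟩

end Run

/-- `for x < y do c`, for registers `x` and `y`. -/
def Cmd.loop (x y : ℕ) (c : Cmd) : Cmd :=
  Cmd.seq (Cmd.assign x (Expr.const 0))
    (Cmd.while (Expr.op Op.lt (Expr.var x) (Expr.var y))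
      (Cmd.seq c (Cmd.assign x (Expr.op Op.add (Expr.var x) (Expr.const 1)))))

/-- The invariant is stated with the counter already advanced, so the increment needs no separate
treatment. In units of `(B + 1) ^ 2`, the initialization costs 2, each test 6 and each increment 9;
this is where 17 and 15 come from. -/
theorem Run.loop {O : ℕ → ℕ → ℕ} {B : ℕ} {c : Cmd} {M : Mem} {N : ℕ} {x y n : ℕ}
    (Inv : ℕ → Mem → Prop) (hxy : x ≠ y) (hx : c.setsVar x = false) (hy : c.setsVar y = false)
    (hn : M.var y = n) (h0 : Inv 0 (M.setVar x 0))
    (hstep : ∀ i < n, ∀ M', M'.Bounded B → Agree (Cmd.loop x y c) M M' → M'.var x = i → Inv i M' →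
      Run O B c M' N fun M'' => Inv (i + 1) (M''.setVar x (i + 1))) :
    Run O B (Cmd.loop x y c) M ((n + 1) * (N + 17)) (Inv n) := by
  intro hO hM
  -- The counter never exceeds the content of `y`, hence it fits into `B` bits.
  have hnB : n < 2 ^ B := hn ▸ hM.1 y
  set g : Expr := Expr.op Op.lt (Expr.var x) (Expr.var y) with hg
  set s : Cmd := Cmd.assign x (Expr.op Op.add (Expr.var x) (Expr.const 1)) with hs
  have key : ∀ j i, i + j = n → ∀ M', M'.Bounded B → Agree (Cmd.loop x y c) M M' →
      M'.var x = i → Inv i M' → ∃ M'' t, Exec O (Cmd.while g (Cmd.seq c s)) M' M'' t ∧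
        M''.Bounded B ∧ t ≤ (6 + j * (N + 15)) * (B + 1) ^ 2 ∧ Inv n M'' := by
    intro j
    induction j with
    | zero =>
      intro i hi M' hB hA hxi hI
      obtain rfl : i = n := by omega
      have hyi : M'.var y = i := by
        rw [hA.1 y (by simp [Cmd.loop, Cmd.setsVar, hy, hxy.symm]), hn]
      refine ⟨M', _, Exec.whileFalse ?_, hB, ?_, hI⟩
      · simp [hg, Expr.eval, Op.apply, hxi, hyi]
      · simpa [hg, Expr.units, Expr.growth] using Run.one_add_cost_le hO hB g
    | succ j ih =>
      intro i hi M' hB hA hxi hI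
      have hyi : M'.var y = n := by
        rw [hA.1 y (by simp [Cmd.loop, Cmd.setsVar, hy, hxy.symm]), hn]
      obtain ⟨M₁, t₁, he₁, hB₁, ht₁, hI₁⟩ := hstep i (by omega) M' hB hA hxi hI hO hB
      have hx₁ : M₁.var x = i := by rw [he₁.agree.1 x hx, hxi]
      have hev : (Expr.op Op.add (Expr.var x) (Expr.const 1)).eval O M₁ = i + 1 := by
        simp [Expr.eval, Op.apply, hx₁]
      obtain ⟨M₂, t₂, he₂, hB₂, ht₂, hI₂⟩ := Run.assign (O := O) (B := B) (M := M₁) (x := x)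
        (e := Expr.op Op.add (Expr.var x) (Expr.const 1))
        (Q := fun M₂ => M₂ = M₁.setVar x (i + 1)) (by rw [hev]; omega) (by rw [hev]) hO hB₁
      subst hI₂
      have hA₂ : Agree (Cmd.loop x y c) M (M₁.setVar x (i + 1)) :=
        hA.trans ((he₁.seq he₂).agree.mono (by simp +contextual [Cmd.loop, Cmd.setsVar])
          (by simp +contextual [Cmd.loop, Cmd.setsArr]))
      obtain ⟨M₃, t₃, he₃, hB₃, ht₃, hI₃⟩ := ih (i + 1) (by omega) _ hB₂ hA₂
        (by simp [Mem.setVar]) hI₁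
      refine ⟨M₃, _, Exec.whileTrue ?_ (he₁.seq he₂) he₃, hB₃, ?_, hI₃⟩
      · simp [hg, Expr.eval, Op.apply, hxi, hyi]; omega
      · have hc : 1 + g.cost O M' ≤ 6 * (B + 1) ^ 2 := by
          simpa [hg, Expr.units, Expr.growth] using Run.one_add_cost_le hO hB g
        have ht₂' : t₂ ≤ 9 * (B + 1) ^ 2 := by
          simpa [Expr.units, Expr.growth] using ht₂
        have : (6 + (j + 1) * (N + 15)) * (B + 1) ^ 2 = 6 * (B + 1) ^ 2 + N * (B + 1) ^ 2
          + 9 * (B + 1) ^ 2 + (6 + j * (N + 15)) * (B + 1) ^ 2 := by ring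
        omega
  obtain ⟨M₀, t₀, he₀, hB₀, ht₀, hI₀⟩ := Run.assign (O := O) (B := B) (M := M) (x := x)
    (e := Expr.const 0) (Q := fun M₂ => M₂ = M.setVar x 0)
    (by simp [Expr.eval]) (by simp [Expr.eval]) hO hM
  subst hI₀
  have hA₀ : Agree (Cmd.loop x y c) M (M.setVar x 0) :=
    he₀.agree.mono (by simp +contextual [Cmd.loop, Cmd.setsVar])
      (by simp +contextual [Cmd.loop, Cmd.setsArr])
  obtain ⟨M', t, he, hB, ht, hI⟩ := key n 0 (by omega) _ hB₀ hA₀ (by simp [Mem.setVar]) h0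
  refine ⟨M', _, he₀.seq he, hB, ?_, hI⟩
  have ht₀' : t₀ ≤ 2 * (B + 1) ^ 2 := by simpa [Expr.units, Expr.growth] using ht₀
  have : (n + 1) * (N + 17) = 2 + (6 + n * (N + 15)) + (2 * n + N + 9) := by ring
  rw [this, add_mul, add_mul]
  omega

/-! ### Optimal solutions that are plans -/

section Plans

variable {U R : Type*}

theorem UConstraint.monotone_f (c : UConstraint R) : Monotone c.f :=
  monotone_int_of_le_succ c.f_mono

theorem UConstraint.f_zero (c : UConstraint R) : c.f 0 = 0 :=
  (c.f_eq_zero_iff 0).2 le_rfl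

theorem mem_graph [Fintype R] [DecidableEq U] [DecidableEq R] {π : R → U} {u : U} {r : R} :
    (u, r) ∈ graph π ↔ π r = u := by
  simp [graph]

theorem resourcesOf_graph [Fintype R] [DecidableEq U] [DecidableEq R] (π : R → U) (u : U) :
    resourcesOf (graph π) u = Finset.univ.filter fun r => π r = u := by
  ext r
  simp [resourcesOf, mem_graph]

variable [Fintype U] [DecidableEq U] [DecidableEq R]

theorem mem_usersOf {A : Finset (U × R)} {u : U} {r : R} : u ∈ usersOf A r ↔ (u, r) ∈ A := by
  simp [usersOf]


variable [Fintype R]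

theorem usersOf_graph (π : R → U) (r : R) : usersOf (graph π) r = {π r} := by
  ext u
  simp [mem_usersOf, mem_graph, eq_comm]

theorem complete_graph (π : R → U) : Complete (graph π) := fun r => by
  simp [usersOf_graph]

theorem UConstraint.weight_graph (c : UConstraint R) (π : R → U) :
    c.weight (graph π) = match c.duty with
      | Duty.sod => if π c.fst = π c.snd then c.f 1 else 0
      | Duty.bod => if π c.fst = π c.snd then 0 else c.f 1 := by
  unfold UConstraint.weight maxdiff
  simp only [usersOf_graph]
  cases c.duty
  · by_cases h : π c.fst = π c.snd
    · simp [h]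
    · simp [h, c.f_zero]
  · by_cases h : π c.fst = π c.snd
    · simp [h, c.f_zero]
    · have h' : π c.snd ≠ π c.fst := fun e => h e.symm
      simp [h, h', Finset.sdiff_singleton_eq_erase]

theorem ValuedAPEP.toWSP_weight (I : ValuedAPEP U R) (π : R → U) :
    I.toWSP.weight π = I.weight (graph π) := by
  unfold ValuedWSP.weight ValuedAPEP.weight
  congr 1
  · simp only [resourcesOf_graph]
    rfl
  · refine Finset.sum_congr rfl fun c _ => ?_
    rw [UConstraint.weight_graph]
    simp only [ValuedAPEP.toWSP, WSPConstraint.weight]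
    by_cases h : π (I.con c).fst = π (I.con c).snd <;> cases (I.con c).duty <;> simp [h]

/-- Penalties are monotone and a plan only incurs the values `f 0 = 0` and `f 1`. Hence it suffices
that each constraint violated by the plan has a positive argument of `f` under `A`. -/
theorem ValuedAPEP.exists_plan_le (I : ValuedAPEP U R) {A : Finset (U × R)} (hA : Complete A) :
    ∃ π : R → U, graph π ⊆ A ∧ I.weight (graph π) ≤ I.weight A := by
  -- The user for `r` depends only on the set `A(r)`.
  let π : R → U := fun r => (hA r).choose
  have hπ : ∀ r, π r ∈ usersOf A r := fun r => (hA r).choose_spec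
  -- Choice depends on the set only, since proofs of nonemptiness are irrelevant. This is what makes
  -- the plan respect BoD constraints with `A(r) = A(r')`.
  have hcongr : ∀ r r', usersOf A r = usersOf A r' → π r = π r' := fun r r' h => by
    have : ∀ (s t : Finset U) (hs : s.Nonempty) (ht : t.Nonempty), s = t → hs.choose = ht.choose :=
      fun s t hs ht e => by subst e; rfl
    exact this _ _ _ _ h
  have hsub : graph π ⊆ A := by
    rintro ⟨u, r⟩ h
    rw [mem_graph] at h
    exact h ▸ mem_usersOf.1 (hπ r)
  refine ⟨π, hsub, Nat.add_le_add (Finset.sum_le_sum fun u _ => I.auth.mono _ _ _ fun r hr => ?_)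
    (Finset.sum_le_sum fun c _ => ?_)⟩
  · simp only [resourcesOf, Finset.mem_filter, Finset.mem_univ, true_and] at hr ⊢
    exact hsub hr
  · rw [UConstraint.weight_graph]
    unfold UConstraint.weight
    set d := I.con c
    cases d.duty
    · by_cases h : π d.fst = π d.snd
      · simp only [h, if_true]
        refine d.monotone_f ?_
        have : π d.snd ∈ usersOf A d.fst ∩ usersOf A d.snd :=
          Finset.mem_inter.2 ⟨h ▸ hπ d.fst, hπ d.snd⟩
        exact_mod_cast Finset.card_pos.2 ⟨_, this⟩
      · simp [h]
    · by_cases h : π d.fst = π d.snd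
      · simp [h]
      · simp only [h, if_false]
        refine d.monotone_f ?_
        suffices 0 < maxdiff A d.fst d.snd by exact_mod_cast this
        rw [Nat.pos_iff_ne_zero]
        intro h0
        rw [maxdiff, Nat.max_eq_zero_iff, Finset.card_eq_zero, Finset.card_eq_zero,
          Finset.sdiff_eq_empty_iff_subset, Finset.sdiff_eq_empty_iff_subset] at h0
        exact h (hcongr _ _ (h0.1.antisymm h0.2))

theorem ValuedAPEP.isOptimalSolution_graph_iff (I : ValuedAPEP U R) (π : R → U) :
    I.IsOptimalSolution (graph π) ↔ ∀ π' : R → U, I.weight (graph π) ≤ I.weight (graph π') := by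
  refine ⟨fun h π' => h.2 _ (complete_graph π'), fun h => ⟨complete_graph π, fun A hA => ?_⟩⟩
  obtain ⟨π', -, hle⟩ := I.exists_plan_le hA
  exact (h π').trans hle

theorem ValuedAPEP.isOptimalPlan_toWSP_iff (I : ValuedAPEP U R) (π : R → U) :
    I.toWSP.IsOptimalPlan π ↔ I.IsOptimalSolution (graph π) := by
  simp only [isOptimalSolution_graph_iff, ValuedWSP.IsOptimalPlan, toWSP_weight]

theorem ValuedAPEP.exists_isOptimalSolution (I : ValuedAPEP U R)
    (h : ∃ A : Finset (U × R), Complete A) : ∃ A, I.IsOptimalSolution A := by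
  classical
  obtain ⟨A, hA, hmin⟩ := Finset.exists_min_image
    (Finset.univ.filter fun A : Finset (U × R) => Complete A) I.weight
    (by obtain ⟨A, hA⟩ := h; exact ⟨A, by simpa using hA⟩)
  exact ⟨A, by simpa using hA, fun A' hA' => hmin A' (by simpa using hA')⟩

theorem ValuedAPEP.IsOptimalSolution.exists_subset {I : ValuedAPEP U R} {A : Finset (U × R)}
    (h : I.IsOptimalSolution A) :
    ∃ A' ⊆ A, I.IsOptimalSolution A' ∧ ∀ r, (usersOf A' r).card = 1 := by
  obtain ⟨π, hsub, hle⟩ := I.exists_plan_le h.1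
  exact ⟨graph π, hsub, ⟨complete_graph π, fun A' hA' => hle.trans (h.2 A' hA')⟩, fun r => by
    simp [usersOf_graph]⟩

/-- The part of the weight of a constraint under a plan that is charged to a user who performs
exactly the steps in `S`. -/
def UConstraint.charge (c : UConstraint R) (S : Finset R) : ℕ :=
  match c.duty with
  | Duty.sod => if c.fst ∈ S ∧ c.snd ∈ S then c.f 1 else 0
  | Duty.bod => if c.fst ∈ S ∧ c.snd ∉ S then c.f 1 else 0

/-- The cost of letting the user `u` perform exactly the steps in `S`. -/
def ValuedAPEP.userCost (I : ValuedAPEP U R) (u : U) (S : Finset R) : ℕ :=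
  I.auth.ω u S + ∑ c, (I.con c).charge S

/-- Both charges require `c.fst ∈ S`, so only the user `π c.fst` can be charged and a violation is
counted once. -/
theorem UConstraint.weight_graph_eq_sum (c : UConstraint R) (π : R → U) :
    c.weight (graph π) = ∑ u, c.charge (Finset.univ.filter fun r => π r = u) := by
  rw [Finset.sum_eq_single (π c.fst) _ (by simp), weight_graph, charge]
  · cases c.duty <;> simp [eq_comm]
  · intro u _ hu
    unfold charge
    cases c.duty <;> simp [hu.symm]

theorem ValuedAPEP.weight_graph_eq_sum (I : ValuedAPEP U R) (π : R → U) :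
    I.weight (graph π) = ∑ u, I.userCost u (Finset.univ.filter fun r => π r = u) := by
  simp only [weight, userCost, Finset.sum_add_distrib, resourcesOf_graph]
  rw [Finset.sum_comm (s := (Finset.univ : Finset U))]
  simp only [UConstraint.weight_graph_eq_sum]

end Plans

/-! ### Sets of resources as bit masks -/

/-- The set of resources with bit mask `t`. -/
def bits (k t : ℕ) : Finset (Fin k) :=
  Finset.univ.filter fun r : Fin k => t.testBit r = true

/-- The bit mask of a set of resources. -/
def mask {k : ℕ} (S : Finset (Fin k)) : ℕ :=
  ∑ r ∈ S, 2 ^ (r : ℕ)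

variable {k : ℕ}

theorem mem_bits {t : ℕ} {r : Fin k} : r ∈ bits k t ↔ t / 2 ^ (r : ℕ) % 2 = 1 := by
  simp [bits, Nat.testBit_eq_decide_div_mod_eq]

theorem bits_mask (S : Finset (Fin k)) : bits k (mask S) = S := by
  have h := Finset.toFinset_bitIndices_sum_two_pow (S.map Fin.valEmbedding)
  rw [Finset.sum_map] at h
  ext r
  have hr : (r : ℕ) ∈ (∑ i ∈ S, 2 ^ (i : ℕ)).bitIndices.toFinset ↔
      (r : ℕ) ∈ S.map Fin.valEmbedding := iff_of_eq (congrArg (fun s => (r : ℕ) ∈ s) h)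
  rw [List.mem_toFinset, Nat.mem_bitIndices] at hr
  rw [bits, Finset.mem_filter]
  simpa [mask, Fin.val_inj] using hr

theorem mask_bits {t : ℕ} (ht : t < 2 ^ k) : mask (bits k t) = t := by
  conv_rhs => rw [← Finset.sum_toFinset_bitIndices_two_pow t]
  have h : t.bitIndices.toFinset = (bits k t).map Fin.valEmbedding := by
    ext i
    simp only [List.mem_toFinset, Nat.mem_bitIndices, Finset.mem_map, bits, Finset.mem_filter,
      Finset.mem_univ, true_and, Fin.valEmbedding_apply]
    refine ⟨fun hi => ⟨⟨i, ?_⟩, hi, rfl⟩, ?_⟩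
    · by_contra hk
      exact absurd (Nat.ge_two_pow_of_testBit hi) (not_le.2
        (ht.trans_le (Nat.pow_le_pow_right (by norm_num) (not_lt.1 hk))))
    · rintro ⟨r, hr, rfl⟩
      exact hr
  rw [h, Finset.sum_map]
  rfl

theorem mask_univ (k : ℕ) : mask (Finset.univ : Finset (Fin k)) = 2 ^ k - 1 := by
  rw [mask, Fin.sum_univ_eq_sum_range (fun i => 2 ^ i), Nat.geomSum_eq le_rfl]
  simp

theorem mask_lt (S : Finset (Fin k)) : mask S < 2 ^ k := by
  have h : mask S ≤ mask (Finset.univ : Finset (Fin k)) :=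
    Finset.sum_le_sum_of_subset (Finset.subset_univ S)
  rw [mask_univ] at h
  have := Nat.two_pow_pos k
  omega

theorem bits_full (k : ℕ) : bits k (2 ^ k - 1) = Finset.univ := by
  rw [← mask_univ, bits_mask]

/-- Subtracting the mask of a subset causes no borrow; hence the program can form set differences by
subtraction. -/
theorem mask_sdiff {S T : Finset (Fin k)} (h : S ⊆ T) : mask T - mask S = mask (T \ S) := by
  have := Finset.sum_sdiff (f := fun r : Fin k => 2 ^ (r : ℕ)) h
  simp only [mask]
  omega

/-- `S` is the bit mask of a subset of the set with bit mask `T`. -/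
def Submask (k S T : ℕ) : Prop :=
  S < 2 ^ k ∧ ∀ s < k, S / 2 ^ s % 2 ≤ T / 2 ^ s % 2

theorem submask_iff {S T : ℕ} : Submask k S T ↔ S < 2 ^ k ∧ bits k S ⊆ bits k T := by
  refine and_congr_right fun _ => ⟨fun h r hr => ?_, fun h s hs => ?_⟩
  · rw [mem_bits] at hr ⊢
    have := h r r.2
    omega
  · have := @h ⟨s, hs⟩
    simp only [mem_bits] at this
    omega

theorem submask_zero (k T : ℕ) : Submask k 0 T :=
  ⟨Nat.two_pow_pos k, by simp⟩

theorem bits_sub {S T : ℕ} (hT : T < 2 ^ k) (h : Submask k S T) :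
    bits k (T - S) = bits k T \ bits k S := by
  obtain ⟨hS, hsub⟩ := submask_iff.1 h
  rw [← mask_bits hT, ← mask_bits hS, mask_sdiff (by simpa [bits_mask] using hsub)]
  simp only [bits_mask]

/-! ### The recurrence for the least cost of a plan -/

/-- Among all `S < i` that are submasks of `T`, and `c`, the least value of
`p (T - S) + φ S` is `d`, and it is attained at the submask `c`. -/
def IsBest (k : ℕ) (p φ : ℕ → ℕ) (T i d c : ℕ) : Prop :=
  Submask k c T ∧ d = p (T - c) + φ c ∧ ∀ S < i, Submask k S T → d ≤ p (T - S) + φ S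

/-- `D u T` is the least cost of a distribution of the set `T` to the users `0, …, u`, and `C u T`
is the part of the user `u` in an optimal distribution, for `u ≤ N`. -/
structure IsTable (k N : ℕ) (Φ D C : ℕ → ℕ → ℕ) : Prop where
  zero : ∀ T < 2 ^ k, D 0 T = Φ 0 T
  succ : ∀ u < N, ∀ T < 2 ^ k, IsBest k (D u) (Φ (u + 1)) T (2 ^ k) (D (u + 1) T) (C (u + 1) T)

namespace IsTable

variable {N : ℕ} {Φ D C : ℕ → ℕ → ℕ}

/-- Giving each user `u + 1` the empty part adds at most `V` per row. The bound shows that table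
entries stay short. -/
theorem le_mul (h : IsTable k N Φ D C) {V : ℕ} (hV : ∀ u, ∀ T < 2 ^ k, Φ u T ≤ V) {u : ℕ}
    (hu : u ≤ N)
    {T : ℕ} (hT : T < 2 ^ k) : D u T ≤ (u + 1) * V := by
  induction u with
  | zero => simpa [h.zero T hT] using hV 0 T hT
  | succ u ih =>
    have := (h.succ u hu T hT).2.2 0 (Nat.two_pow_pos k) (submask_zero k T)
    have := ih (by omega)
    have := hV (u + 1) 0 (Nat.two_pow_pos k)
    rw [Nat.sub_zero] at *
    rw [add_mul (u + 1)]
    omega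

/-- Optimality: the fibre of `σ` over `u + 1` is one of the competitors in the minimum for row `u +
1`, and removing it leaves the resources with `σ r ≤ u`. -/
theorem le_sum (h : IsTable k N Φ D C) (σ : Fin k → ℕ) {u : ℕ} (hu : u ≤ N) :
    D u (mask (Finset.univ.filter fun r => σ r ≤ u)) ≤
      ∑ j ∈ Finset.range (u + 1), Φ j (mask (Finset.univ.filter fun r => σ r = j)) := by
  induction u with
  | zero =>
    rw [h.zero _ (mask_lt _)]
    simp
  | succ u ih =>
    have hsub : (Finset.univ.filter fun r => σ r = u + 1) ⊆
        Finset.univ.filter fun r => σ r ≤ u + 1 := fun r hr => by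
      simp only [Finset.mem_filter, Finset.mem_univ, true_and] at hr ⊢
      omega
    have hle := (h.succ u hu _ (mask_lt (Finset.univ.filter fun r => σ r ≤ u + 1))).2.2 _
      (mask_lt (Finset.univ.filter fun r => σ r = u + 1))
      (submask_iff.2 ⟨mask_lt _, by simpa only [bits_mask] using hsub⟩)
    have hsd : ((Finset.univ.filter fun r => σ r ≤ u + 1) \
        Finset.univ.filter fun r => σ r = u + 1) = Finset.univ.filter fun r => σ r ≤ u := by
      ext r
      simp only [Finset.mem_sdiff, Finset.mem_filter, Finset.mem_univ, true_and]
      omega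
    rw [mask_sdiff hsub, hsd] at hle
    rw [Finset.sum_range_succ]
    exact hle.trans (Nat.add_le_add_right (ih (by omega)) _)

end IsTable

/-- The set that remains to be distributed after `i` users, starting from the user `N`, have
received their parts. -/
def remaining (k N : ℕ) (C : ℕ → ℕ → ℕ) : ℕ → ℕ
  | 0 => 2 ^ k - 1
  | i + 1 => remaining k N C i - C (N - i) (remaining k N C i)

/-- The part of the user `u`. -/
def part (k N : ℕ) (C : ℕ → ℕ → ℕ) (u : ℕ) : ℕ :=
  if u = 0 then remaining k N C N else C u (remaining k N C (N - u))

theorem remaining_lt (k N : ℕ) (C : ℕ → ℕ → ℕ) (i : ℕ) : remaining k N C i < 2 ^ k := by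
  induction i with
  | zero => have := Nat.two_pow_pos k; simp only [remaining]; omega
  | succ i ih => exact (Nat.sub_le _ _).trans_lt ih

namespace IsTable

variable {N : ℕ} {Φ D C : ℕ → ℕ → ℕ}

theorem remaining_eq_sub {u : ℕ} (hu : u < N) :
    remaining k N C (N - u) =
      remaining k N C (N - (u + 1)) - C (u + 1) (remaining k N C (N - (u + 1))) := by
  obtain ⟨i, rfl⟩ : ∃ i, N = u + 1 + i := ⟨N - (u + 1), by omega⟩
  have h1 : u + 1 + i - u = i + 1 := by omega
  have h2 : u + 1 + i - (u + 1) = i := by omega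
  rw [h1, h2, remaining]
  congr 2
  omega

/-- Attainment: following the minimizers `C` down from user `N` unrolls the recurrence, and user `0`
takes all that is left. -/
theorem eq_sum (h : IsTable k N Φ D C) {u : ℕ} (hu : u ≤ N) :
    D u (remaining k N C (N - u)) = ∑ j ∈ Finset.range (u + 1), Φ j (part k N C j) := by
  induction u with
  | zero =>
    rw [h.zero _ (remaining_lt _ _ _ _)]
    simp [part]
  | succ u ih =>
    rw [(h.succ u hu _ (remaining_lt _ _ _ _)).2.1, ← remaining_eq_sub hu, ih (by omega),
      Finset.sum_range_succ _ (u + 1)]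
    simp [part]

/-- The parts partition what remains. The second conjunct is needed for uniqueness in the induction:
parts of smaller users lie in the remainder, which is disjoint from the part of user `u + 1`. -/
theorem existsUnique_part (h : IsTable k N Φ D C) {u : ℕ} (hu : u ≤ N) (r : Fin k) :
    (r ∈ bits k (remaining k N C (N - u)) → ∃! j, j ≤ u ∧ r ∈ bits k (part k N C j)) ∧
      ∀ j ≤ u, r ∈ bits k (part k N C j) → r ∈ bits k (remaining k N C (N - u)) := by
  induction u with
  | zero =>
    refine ⟨fun hr => ⟨0, ⟨le_rfl, by simpa [part] using hr⟩, fun j hj => by omega⟩,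
      fun j hj hr => ?_⟩
    obtain rfl : j = 0 := by omega
    simpa [part] using hr
  | succ u ih =>
    have hT := remaining_lt k N C (N - (u + 1))
    have hsub := (h.succ u hu _ hT).1
    have hbits := bits_sub hT hsub
    rw [← remaining_eq_sub hu] at hbits
    have hp : part k N C (u + 1) = C (u + 1) (remaining k N C (N - (u + 1))) := by simp [part]
    obtain ⟨ih₁, ih₂⟩ := ih (by omega)
    rw [hbits, Finset.mem_sdiff, ← hp] at ih₁ ih₂
    rw [← hp] at hsub
    refine ⟨fun hr => ?_, fun j hj hr => ?_⟩
    · by_cases hc : r ∈ bits k (part k N C (u + 1))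
      · refine ⟨u + 1, ⟨le_rfl, hc⟩, fun j hj => ?_⟩
        by_contra hne
        exact (ih₂ j (by omega) hj.2).2 hc
      · obtain ⟨j, hj, huniq⟩ := ih₁ ⟨hr, hc⟩
        refine ⟨j, ⟨by omega, hj.2⟩, fun i hi => huniq i ⟨?_, hi.2⟩⟩
        have : i ≠ u + 1 := fun e => hc (e ▸ hi.2)
        omega
    · rcases Nat.lt_or_ge j (u + 1) with hlt | hge
      · exact (ih₂ j (by omega) hr).1
      · obtain rfl : j = u + 1 := by omega
        exact (submask_iff.1 hsub).2 hr

end IsTable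

/-- The table of least costs yields an optimal solution. -/
theorem ValuedAPEP.isOptimalSolution_of_isTable {n : ℕ} (I : ValuedAPEP (Fin (n + 1)) (Fin k))
    {Φ D C : ℕ → ℕ → ℕ} (h : IsTable k n Φ D C)
    (hΦ : ∀ (u : Fin (n + 1)) (T : ℕ), T < 2 ^ k → Φ u T = I.userCost u (bits k T))
    (A : Finset (Fin (n + 1) × Fin k))
    (hA : ∀ (u : Fin (n + 1)) (r : Fin k), (u, r) ∈ A ↔ r ∈ bits k (part k n C u)) :
    I.IsOptimalSolution A := by
  have hpart : ∀ u ≤ n, part k n C u < 2 ^ k := by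
    intro u hu
    unfold part
    split_ifs with h0
    · exact remaining_lt _ _ _ _
    · obtain ⟨v, rfl⟩ := Nat.exists_eq_succ_of_ne_zero h0
      exact (h.succ v hu _ (remaining_lt _ _ _ _)).1.1
  -- At the start everything remains, so each resource has exactly one owner, and the parts are the
  -- fibres of a plan.
  have hex : ∀ r : Fin k, ∃! j, j ≤ n ∧ r ∈ bits k (part k n C j) := fun r =>
    (h.existsUnique_part le_rfl r).1 (by simp [remaining, bits_full])
  choose σ hσ huniq using hex
  let π : Fin k → Fin (n + 1) := fun r => ⟨σ r, Nat.lt_succ_of_le (hσ r).1⟩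
  have hgraph : A = graph π := by
    ext ⟨u, r⟩
    rw [hA, mem_graph]
    refine ⟨fun hr => Fin.ext (huniq r u ⟨by omega, hr⟩).symm, ?_⟩
    rintro rfl
    exact (hσ r).2
  have hfib : ∀ u : Fin (n + 1), (Finset.univ.filter fun r => π r = u) = bits k (part k n C u) := by
    intro u
    ext r
    rw [← hA, hgraph, mem_graph]
    simp
  rw [hgraph, isOptimalSolution_graph_iff]
  intro π'
  have hle := h.le_sum (fun r => (π' r : ℕ)) le_rfl
  have hall : (Finset.univ.filter fun r => (π' r : ℕ) ≤ n) = Finset.univ := by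
    ext r
    simp only [Finset.mem_filter, Finset.mem_univ, true_and, iff_true]
    omega
  have heq := h.eq_sum le_rfl
  rw [Nat.sub_self, remaining] at heq
  rw [hall, mask_univ, heq, Finset.sum_range, Finset.sum_range] at hle
  rw [weight_graph_eq_sum, weight_graph_eq_sum]
  refine (le_of_eq ?_).trans (hle.trans (le_of_eq ?_))
  · refine Finset.sum_congr rfl fun u _ => ?_
    rw [hfib, hΦ u _ (hpart u (by omega))]
  · refine Finset.sum_congr rfl fun u _ => ?_
    rw [hΦ u _ (mask_lt _), bits_mask]
    congr 1
    ext r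
    simp [Fin.ext_iff]

/-! ### A program for the table of least costs -/

/-- Arithmetic notation for programs; the `simp` lemmas below return to the constructors, so that
values and unit costs can be computed by `simp`. -/
instance : Add Expr := ⟨Expr.op Op.add⟩
instance : Sub Expr := ⟨Expr.op Op.sub⟩
instance : Mul Expr := ⟨Expr.op Op.mul⟩
instance : Div Expr := ⟨Expr.op Op.div⟩
instance : Mod Expr := ⟨Expr.op Op.mod⟩
instance (n : ℕ) : OfNat Expr n := ⟨Expr.const n⟩

namespace Expr

@[simp] theorem add_def (e₁ e₂ : Expr) : e₁ + e₂ = op Op.add e₁ e₂ := rfl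
@[simp] theorem sub_def (e₁ e₂ : Expr) : e₁ - e₂ = op Op.sub e₁ e₂ := rfl
@[simp] theorem mul_def (e₁ e₂ : Expr) : e₁ * e₂ = op Op.mul e₁ e₂ := rfl
@[simp] theorem div_def (e₁ e₂ : Expr) : e₁ / e₂ = op Op.div e₁ e₂ := rfl
@[simp] theorem mod_def (e₁ e₂ : Expr) : e₁ % e₂ = op Op.mod e₁ e₂ := rfl
@[simp] theorem ofNat_def (n : ℕ) : (OfNat.ofNat n : Expr) = const n := rfl

attribute [simp] eval growth units

end Expr

attribute [simp] Op.apply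

@[simp] theorem size_two : Nat.size 2 = 2 :=
  Nat.size_pow (n := 1)

namespace Mem

@[simp] theorem setVar_var (M : Mem) (x v y : ℕ) :
    (M.setVar x v).var y = if y = x then v else M.var y := by
  simp [setVar, Function.update_apply]

@[simp] theorem setVar_arr (M : Mem) (x v : ℕ) : (M.setVar x v).arr = M.arr := rfl

@[simp] theorem setCell_var (M : Mem) (a i v : ℕ) : (M.setCell a i v).var = M.var := rfl

@[simp] theorem setCell_arr (M : Mem) (a i v b j : ℕ) :
    (M.setCell a i v).arr b j = if b = a ∧ j = i then v else M.arr b j := by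
  by_cases h : b = a
  · subst h
    simp [setCell, Function.update_apply]
  · simp [setCell, h]

end Mem

/-- Bit number `s` of the register `x`, if array `5` holds the powers of two. -/
def bitExpr (x : ℕ) (s : Expr) : Expr :=
  Expr.var x / Expr.cell 5 s % 2

/-- Store the powers of two in array `5`, and `2 ^ k` in register `3`. -/
def powersCmd : Cmd :=
  .seq (.assign 3 1) (.loop 8 0 (.seq (.write 5 (.var 8) (.var 3)) (.assign 3 (.var 3 * 2))))

/-- Add the charge of the constraint in register `7` for the set in register `4` to
register `11`. -/
def chargeCmd : Cmd :=
  .assign 11 (.var 11 + .cell 3 (.var 7 * (.var 1 + 1) + 1) *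
    (bitExpr 4 (.cell 1 (.var 7)) * .op .eq (bitExpr 4 (.cell 2 (.var 7)) + .cell 0 (.var 7)) 1))

/-- Store the total charges of all sets of resources in array `6`. -/
def chargesCmd : Cmd :=
  .loop 4 3 (.seq (.assign 11 0) (.seq (.loop 7 2 chargeCmd) (.write 6 (.var 4) (.var 11))))

/-- Store in register `9` whether register `4` holds a submask of register `5`. -/
def submaskCmd : Cmd :=
  .seq (.assign 9 1)
    (.loop 8 0 (.ite (.op .lt (bitExpr 5 (.var 8)) (bitExpr 4 (.var 8))) (.assign 9 0) .skip))

/-- Improve the best cost and part in the registers `11` and `12` by trying all possible parts. -/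
def searchCmd : Cmd :=
  .loop 4 3 (.seq submaskCmd (.ite (.var 9)
    (.seq (.assign 10 (.cell 7 (.var 6 * .var 3 + (.var 5 - .var 4)) +
        (.query (.var 6 + 1) (.var 4) + .cell 6 (.var 4))))
      (.ite (.op .lt (.var 10) (.var 11))
        (.seq (.assign 11 (.var 10)) (.assign 12 (.var 4))) .skip)) .skip))

/-- Compute the table entry in the row after register `6` and the column in register `5`. -/
def entryCmd : Cmd :=
  .seq (.assign 11 (.cell 7 (.var 6 * .var 3 + .var 5) + (.query (.var 6 + 1) 0 + .cell 6 0)))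
    (.seq (.assign 12 0) (.seq searchCmd
      (.seq (.write 7 ((.var 6 + 1) * .var 3 + .var 5) (.var 11))
        (.write 8 ((.var 6 + 1) * .var 3 + .var 5) (.var 12)))))

/-- Compute the table of least costs in array `7`, and the parts that attain them in array `8`. -/
def tableCmd : Cmd :=
  .seq (.loop 5 3 (.write 7 (.var 5) (.query 0 (.var 5) + .cell 6 (.var 5))))
    (.seq (.assign 13 (.var 1 - 1)) (.loop 6 13 (.loop 5 3 entryCmd)))

/-- Write the authorization relation that belongs to the table into array `4`. -/
def outputCmd : Cmd :=
  .seq (.assign 5 (.var 3 - 1)) (.seq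
    (.loop 6 13 (.seq (.assign 12 (.cell 8 ((.var 13 - .var 6) * .var 3 + .var 5)))
      (.seq (.loop 8 0 (.write 4 ((.var 13 - .var 6) * .var 0 + .var 8) (bitExpr 12 (.var 8))))
        (.assign 5 (.var 5 - .var 12)))))
    (.loop 8 0 (.write 4 (.var 8) (bitExpr 5 (.var 8)))))

/-- A program for Valued APEP with universal constraints. -/
def solveCmd : Cmd :=
  .seq powersCmd (.seq chargesCmd (.seq tableCmd outputCmd))

/-- Register `0` holds `k`, register `3` and array `5` hold powers of two. -/
structure HasPowers (k : ℕ) (M : Mem) : Prop where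
  var_zero : M.var 0 = k
  var_three : M.var 3 = 2 ^ k
  arr_five : ∀ s < k, M.arr 5 s = 2 ^ s

theorem HasPowers.of_agree {k : ℕ} {c : Cmd} {M M' : Mem} (h : HasPowers k M) (hA : Agree c M M')
    (h0 : c.setsVar 0 = false) (h3 : c.setsVar 3 = false) (h5 : c.setsArr 5 = false) :
    HasPowers k M' where
  var_zero := (hA.1 0 h0).trans h.var_zero
  var_three := (hA.1 3 h3).trans h.var_three
  arr_five s hs := (congrFun (hA.2 5 h5) s).trans (h.arr_five s hs)

/-! ### Specifications of the subroutines -/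

section Specs

variable {O : ℕ → ℕ → ℕ} {B k : ℕ} {M : Mem}

/-- The numerical constants here and in the later specifications are generous roundings; after
`Run.of_le` the actual unit count is computed and compared with them. -/
theorem run_powersCmd (hk : M.var 0 = k) (hB : 2 ^ k < 2 ^ B) :
    Run O B powersCmd M ((k + 1) * 100) (HasPowers k) := by
  have hkB : k < B := (Nat.pow_lt_pow_iff_right (by norm_num)).1 hB
  apply Run.of_le
  · apply Run.seq
    apply Run.assign
    · simp; omega
    refine (Run.loop (n := k) (N := 60) (fun i M' => M'.var 3 = 2 ^ i ∧ ∀ s < i, M'.arr 5 s = 2 ^ s)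
      (by decide) rfl rfl (by simpa) (by simp) ?_).mono le_rfl fun M' _ hA h => ⟨?_, h.1, h.2⟩
    · rintro i hi M' - - hx ⟨h3, h5⟩
      have hp : 2 ^ (i + 1) < 2 ^ B := Nat.pow_lt_pow_right (by norm_num) (by omega)
      rw [pow_succ] at hp
      apply Run.of_le
      · apply Run.seq
        apply Run.write
        · simp only [Expr.eval, h3]; omega
        apply Run.assign
        · simpa [h3] using hp
        refine ⟨by simp [h3, pow_succ], fun s hs => ?_⟩
        simp only [Mem.setVar_arr, Mem.setCell_arr, Expr.eval, hx, h3, true_and]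
        split_ifs with h
        · rw [h]
        · exact h5 s (by omega)
      · simp
    · rw [hA.1 0 rfl]
      simpa
  · simp
    omega

theorem eval_bitExpr {x s : ℕ} {e : Expr} (h5 : M.arr 5 (e.eval O M) = 2 ^ s) :
    (bitExpr x e).eval O M = M.var x / 2 ^ s % 2 := by
  simp [bitExpr, h5]

theorem run_submaskCmd (hP : HasPowers k M) (hB : 0 < B) :
    Run O B submaskCmd M ((k + 1) * 200) fun M' =>
      M'.var 9 ≠ 0 ↔ ∀ s < k, M.var 4 / 2 ^ s % 2 ≤ M.var 5 / 2 ^ s % 2 := by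
  apply Run.of_le
  · apply Run.seq
    apply Run.assign
    · simp; omega
    refine Run.loop (n := k) (N := 120) (fun i M' =>
      M'.var 9 ≠ 0 ↔ ∀ s < i, M.var 4 / 2 ^ s % 2 ≤ M.var 5 / 2 ^ s % 2)
      (by decide) rfl rfl (by simpa using hP.var_zero) (by simp) ?_
    intro i hi M' _ hA hx hI
    have h5 : M'.arr 5 ((Expr.var 8).eval O M') = 2 ^ i := by
      rw [hA.2 5 rfl, Expr.eval, hx]; exact hP.arr_five i hi
    have hb4 : (bitExpr 4 (.var 8)).eval O M' = M.var 4 / 2 ^ i % 2 := by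
      rw [eval_bitExpr h5, hA.1 4 rfl]; rfl
    have hb5 : (bitExpr 5 (.var 8)).eval O M' = M.var 5 / 2 ^ i % 2 := by
      rw [eval_bitExpr h5, hA.1 5 rfl]; rfl
    apply Run.of_le
    · apply Run.ite
      · intro h
        have hlt : M.var 5 / 2 ^ i % 2 < M.var 4 / 2 ^ i % 2 := by simpa [hb4, hb5] using h
        apply Run.assign
        · simp
        simp only [Mem.setVar_var, Nat.forall_lt_succ_right]
        simp [hlt]
      · intro h
        have hle : M.var 4 / 2 ^ i % 2 ≤ M.var 5 / 2 ^ i % 2 := by simpa [hb4, hb5] using h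
        apply Run.skip
        rw [Nat.forall_lt_succ_right]
        simpa [hle] using hI
    · simp [bitExpr]
  · simp
    omega

end Specs

/-- The charge that the program computes for the constraint `c` and the set with mask `S`. -/
def chargeValue (M : Mem) (n c S : ℕ) : ℕ :=
  M.arr 3 (c * (n + 1) + 1) * (S / 2 ^ M.arr 1 c % 2 *
    if S / 2 ^ M.arr 2 c % 2 + M.arr 0 c = 1 then 1 else 0)

section Specs

variable {O : ℕ → ℕ → ℕ} {B k : ℕ} {M : Mem}

theorem run_chargesCmd {n m : ℕ} (hP : HasPowers k M) (h1 : M.var 1 = n) (h2 : M.var 2 = m)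
    (ha1 : ∀ c < m, M.arr 1 c < k) (ha2 : ∀ c < m, M.arr 2 c < k)
    (hV : ∀ S < 2 ^ k, ∑ c ∈ Finset.range m, chargeValue M n c S < 2 ^ B) :
    Run O B chargesCmd M ((2 ^ k + 1) * ((m + 1) * 1000)) fun M' =>
      ∀ S < 2 ^ k, M'.arr 6 S = ∑ c ∈ Finset.range m, chargeValue M n c S := by
  refine (Run.loop (n := 2 ^ k) (N := (m + 1) * 900) (fun i M' =>
    ∀ S < i, M'.arr 6 S = ∑ c ∈ Finset.range m, chargeValue M n c S)
    (by decide) rfl rfl hP.var_three (by simp) ?_).of_le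
    (Nat.mul_le_mul_left _ (by omega))
  intro S hS M₁ _ hA hx hI
  apply Run.of_le
  · apply Run.seq
    apply Run.assign
    · simp
    apply Run.seq
    refine (Run.loop (n := m) (N := 800) (fun i M' =>
      M'.var 11 = ∑ c ∈ Finset.range i, chargeValue M n c S)
      (by decide) rfl rfl (by simpa [hA.1 2 rfl]) (by simp) ?_).mono le_rfl
      fun M₂ hB₂ hA₂ h => ?_
    · intro c hc M₂ _ hA₂ hx₂ hI₂
      have hp : ∀ r < k, M₂.arr 5 r = 2 ^ r := fun r hr => by
        rw [hA₂.2 5 rfl, Mem.setVar_arr, hA.2 5 rfl]; exact hP.arr_five r hr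
      have e0 : M₂.arr 0 = M.arr 0 := (hA₂.2 0 rfl).trans (hA.2 0 rfl)
      have e1 : M₂.arr 1 = M.arr 1 := (hA₂.2 1 rfl).trans (hA.2 1 rfl)
      have e2 : M₂.arr 2 = M.arr 2 := (hA₂.2 2 rfl).trans (hA.2 2 rfl)
      have e3 : M₂.arr 3 = M.arr 3 := (hA₂.2 3 rfl).trans (hA.2 3 rfl)
      have v1 : M₂.var 1 = n := (hA₂.1 1 rfl).trans ((hA.1 1 rfl).trans h1)
      have v4 : M₂.var 4 = S := (hA₂.1 4 rfl).trans hx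
      have hb1 : (bitExpr 4 (.cell 1 (.var 7))).eval O M₂ = S / 2 ^ M.arr 1 c % 2 := by
        rw [eval_bitExpr (s := M.arr 1 c), v4]
        simpa [hx₂, e1] using hp _ (ha1 c hc)
      have hb2 : (bitExpr 4 (.cell 2 (.var 7))).eval O M₂ = S / 2 ^ M.arr 2 c % 2 := by
        rw [eval_bitExpr (s := M.arr 2 c), v4]
        simpa [hx₂, e2] using hp _ (ha2 c hc)
      have hev : (Expr.var 11 + .cell 3 (.var 7 * (.var 1 + 1) + 1) *
          (bitExpr 4 (.cell 1 (.var 7)) *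
            .op .eq (bitExpr 4 (.cell 2 (.var 7)) + .cell 0 (.var 7)) 1)).eval O M₂ =
          ∑ c ∈ Finset.range (c + 1), chargeValue M n c S := by
        rw [Finset.sum_range_succ, chargeValue, ← hI₂]
        simp [hb1, hb2, e0, e3, v1, hx₂]
      apply Run.of_le
      · apply Run.assign
        · rw [hev]
          -- Partial sums are bounded by the full sum, so the accumulator never overflows `B` bits.
          exact (Finset.sum_le_sum_of_subset (Finset.range_mono hc)).trans_lt (hV S hS)
        rw [hev]
        simp
      · simp [bitExpr]
    have h4 : M₂.var 4 = S := (hA₂.1 4 rfl).trans hx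
    apply Run.write
    · simpa using hB₂.1 11
    intro S' hS'
    simp only [Expr.eval, Mem.setVar_arr, Mem.setCell_arr, h4, true_and]
    split_ifs with he
    · rw [he, h]
    · rw [hA₂.2 6 rfl]
      exact hI S' (by omega)
  · simp
    omega

/-- The loop invariant is `IsBest` restricted to the candidates below the counter; masks that are
not submasks are skipped. -/
theorem run_searchCmd {T u : ℕ} {P D : ℕ → ℕ} (hP : HasPowers k M) (hB : 0 < B)
    (hT : T < 2 ^ k) (h5 : M.var 5 = T) (h6 : M.var 6 = u) (ha6 : M.arr 6 = P)
    (ha7 : M.arr 7 = D)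
    (hV : ∀ X < 2 ^ k, ∀ S < 2 ^ k, D (u * 2 ^ k + X) + (O (u + 1) S + P S) < 2 ^ B)
    (hI : IsBest k (fun X => D (u * 2 ^ k + X)) (fun S => O (u + 1) S + P S) T 0
      (M.var 11) (M.var 12)) :
    Run O B searchCmd M ((2 ^ k + 1) * ((k + 1) * 1000)) fun M' =>
      IsBest k (fun X => D (u * 2 ^ k + X)) (fun S => O (u + 1) S + P S) T (2 ^ k)
        (M'.var 11) (M'.var 12) := by
  refine (Run.loop (n := 2 ^ k) (N := (k + 1) * 900) (fun i M' =>
    IsBest k (fun X => D (u * 2 ^ k + X)) (fun S => O (u + 1) S + P S) T i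
      (M'.var 11) (M'.var 12)) (by decide) rfl rfl hP.var_three (by simpa using hI) ?_).of_le
    (Nat.mul_le_mul_left _ (by omega))
  intro S hS M₁ _ hA hx hI
  have hP₁ := hP.of_agree hA rfl rfl rfl
  apply Run.of_le
  · apply Run.seq
    refine (run_submaskCmd hP₁ hB).mono le_rfl fun M₂ hB₂ hA₂ h9 => ?_
    have hA₂' : Agree searchCmd M₁ M₂ := hA₂.mono
      (by simp +contextual [searchCmd, Cmd.loop, Cmd.setsVar])
      (by simp +contextual [searchCmd, Cmd.loop, Cmd.setsArr])
    have hAA := hA.trans hA₂'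
    have v3 : M₂.var 3 = 2 ^ k := (hAA.1 3 rfl).trans hP.var_three
    have v4 : M₂.var 4 = S := (hA₂.1 4 rfl).trans hx
    have v5 : M₂.var 5 = T := (hAA.1 5 rfl).trans h5
    have v6 : M₂.var 6 = u := (hAA.1 6 rfl).trans h6
    have a6 : M₂.arr 6 = P := (hAA.2 6 rfl).trans ha6
    have a7 : M₂.arr 7 = D := (hAA.2 7 rfl).trans ha7
    have hI₂ : IsBest k (fun X => D (u * 2 ^ k + X)) (fun S => O (u + 1) S + P S) T S
        (M₂.var 11) (M₂.var 12) := by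
      rw [hA₂.1 11 rfl, hA₂.1 12 rfl]
      exact hI
    rw [hx, (hA.1 5 rfl).trans h5] at h9
    have hsub : M₂.var 9 ≠ 0 ↔ Submask k S T := h9.trans ⟨fun h => ⟨hS, h⟩, fun h => h.2⟩
    obtain ⟨hc, hd, hmin⟩ := hI₂
    have hev : (Expr.cell 7 (.var 6 * .var 3 + (.var 5 - .var 4)) +
        (.query (.var 6 + 1) (.var 4) + .cell 6 (.var 4))).eval O M₂ =
        D (u * 2 ^ k + (T - S)) + (O (u + 1) S + P S) := by
      simp [v3, v4, v5, v6, a6, a7]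
    apply Run.ite
    · intro h
      replace h : Submask k S T := hsub.1 (by simpa using h)
      apply Run.seq
      apply Run.assign
      · rw [hev]; exact hV _ (by omega) _ hS
      rw [hev]
      apply Run.ite
      · intro hlt
        replace hlt : D (u * 2 ^ k + (T - S)) + (O (u + 1) S + P S) < M₂.var 11 := by
          simpa using hlt
        apply Run.seq
        apply Run.assign
        · simpa using hV _ (by omega) _ hS
        apply Run.assign
        · simpa using hB₂.1 4
        refine ⟨by simpa [v4] using h, by simp [v4], fun S' hS' h' => ?_⟩
        rcases Nat.lt_or_eq_of_le (Nat.lt_succ_iff.1 hS') with hlt' | rfl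
        · simpa using hlt.le.trans (hmin S' hlt' h')
        · simp
      · intro hge
        replace hge : M₂.var 11 ≤ D (u * 2 ^ k + (T - S)) + (O (u + 1) S + P S) := by
          simpa using hge
        apply Run.skip
        refine ⟨by simpa using hc, by simpa using hd, fun S' hS' h' => ?_⟩
        rcases Nat.lt_or_eq_of_le (Nat.lt_succ_iff.1 hS') with hlt' | rfl
        · simpa using hmin S' hlt' h'
        · simpa using hge
    · intro h
      replace h : ¬ Submask k S T := fun hs => hsub.2 hs (by simpa using h)
      apply Run.skip
      refine ⟨by simpa using hc, by simpa using hd, fun S' hS' h' => ?_⟩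
      rcases Nat.lt_or_eq_of_le (Nat.lt_succ_iff.1 hS') with hlt' | rfl
      · simpa using hmin S' hlt' h'
      · exact absurd h' h
  · simp
    omega

theorem run_entryCmd {T u : ℕ} {P D : ℕ → ℕ} (hP : HasPowers k M) (hB : 0 < B)
    (hT : T < 2 ^ k) (h5 : M.var 5 = T) (h6 : M.var 6 = u) (ha6 : M.arr 6 = P)
    (ha7 : M.arr 7 = D)
    (hV : ∀ X < 2 ^ k, ∀ S < 2 ^ k, D (u * 2 ^ k + X) + (O (u + 1) S + P S) < 2 ^ B) :
    Run O B entryCmd M ((2 ^ k + 1) * ((k + 1) * 1100)) fun M' => ∃ d c,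
      IsBest k (fun X => D (u * 2 ^ k + X)) (fun S => O (u + 1) S + P S) T (2 ^ k) d c ∧
        M'.arr 7 = Function.update D ((u + 1) * 2 ^ k + T) d ∧
        M'.arr 8 = Function.update (M.arr 8) ((u + 1) * 2 ^ k + T) c := by
  apply Run.of_le
  · apply Run.seq
    have v3 := hP.var_three
    have hev : (Expr.cell 7 (.var 6 * .var 3 + .var 5) +
        (.query (.var 6 + 1) 0 + .cell 6 0)).eval O M =
        D (u * 2 ^ k + T) + (O (u + 1) 0 + P 0) := by
      simp [v3, h5, h6, ha6, ha7]
    apply Run.assign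
    · rw [hev]; exact hV _ hT _ (Nat.two_pow_pos k)
    apply Run.seq
    apply Run.assign
    · simp
    apply Run.seq
    refine (run_searchCmd (T := T) (u := u) (P := P) (D := D)
      ⟨by simpa using hP.var_zero, by simpa using hP.var_three,
      by simpa using hP.arr_five⟩ hB hT (by simpa) (by simpa) (by simpa) (by simpa) hV ?_).mono
      le_rfl fun M₂ hB₂ hA₂ h => ?_
    · rw [hev]
      -- The search starts from the empty part, always a submask, so the stored value is attained
      -- from the outset and no infinite value is needed.
      exact ⟨by simpa using submask_zero k T, by simp, fun S hS => absurd hS (Nat.not_lt_zero S)⟩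
    have w3 : M₂.var 3 = 2 ^ k := (hA₂.1 3 rfl).trans v3
    have w5 : M₂.var 5 = T := (hA₂.1 5 rfl).trans h5
    have w6 : M₂.var 6 = u := (hA₂.1 6 rfl).trans h6
    have a7 : M₂.arr 7 = D := (hA₂.2 7 rfl).trans ha7
    have a8 : M₂.arr 8 = M.arr 8 := hA₂.2 8 rfl
    apply Run.seq
    apply Run.write
    · simpa using hB₂.1 11
    apply Run.write
    · simpa using hB₂.1 12
    refine ⟨_, _, h, ?_, ?_⟩
    · ext j
      simp [Function.update_apply, w3, w5, w6, a7]
    · ext j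
      simp [Function.update_apply, w3, w5, w6, a8]
  · simp
    have : 1 ≤ (2 ^ k + 1) * (k + 1) := Nat.mul_pos (by omega) (by omega)
    rw [← mul_assoc, ← mul_assoc]
    omega

end Specs

/-! ### Tables stored row by row, and reading off a solution -/

theorem IsBest.congr {k : ℕ} {p p' φ : ℕ → ℕ} {T i d c : ℕ} (h : IsBest k p φ T i d c)
    (hT : T < 2 ^ k) (hp : ∀ X < 2 ^ k, p X = p' X) : IsBest k p' φ T i d c :=
  ⟨h.1, by rw [← hp _ (by omega)]; exact h.2.1, fun S hS hs => by
    rw [← hp _ (by omega)]; exact h.2.2 S hS hs⟩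

/-- Only rows up to `N` and columns below `2 ^ k` matter, so writing into row `N + 1` preserves a
finished table. -/
theorem IsTable.congr {k N : ℕ} {Φ D D' C C' : ℕ → ℕ → ℕ} (h : IsTable k N Φ D C)
    (hD : ∀ u ≤ N, ∀ T < 2 ^ k, D u T = D' u T) (hC : ∀ u ≤ N, ∀ T < 2 ^ k, C u T = C' u T) :
    IsTable k N Φ D' C' where
  zero T hT := by rw [← hD 0 (Nat.zero_le _) T hT]; exact h.zero T hT
  succ u hu T hT := by
    rw [← hD (u + 1) hu T hT, ← hC (u + 1) hu T hT]
    exact (h.succ u hu T hT).congr hT fun X hX => hD u hu.le X hX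

/-- A table with rows of length `2 ^ k`, stored row by row in an array. -/
def tab (k : ℕ) (a : ℕ → ℕ) (u T : ℕ) : ℕ :=
  a (u * 2 ^ k + T)

theorem mul_add_inj {F u u' T T' : ℕ} (hT : T < F) (hT' : T' < F) :
    u * F + T = u' * F + T' ↔ u = u' ∧ T = T' := by
  refine ⟨fun h => ?_, fun h => by rw [h.1, h.2]⟩
  have hu : u = u' := by
    have := congrArg (· / F) h
    simpa [Nat.mul_comm _ F, Nat.mul_add_div (by omega : 0 < F), Nat.div_eq_of_lt hT,
      Nat.div_eq_of_lt hT'] using this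
  subst hu
  exact ⟨rfl, by omega⟩

theorem tab_update {k : ℕ} {a : ℕ → ℕ} {u u' T T' v : ℕ} (hT : T < 2 ^ k) (hT' : T' < 2 ^ k) :
    tab k (Function.update a (u * 2 ^ k + T) v) u' T' =
      if u' = u ∧ T' = T then v else tab k a u' T' := by
  simp only [tab, Function.update_apply, mul_add_inj hT' hT]

section Specs

variable {O : ℕ → ℕ → ℕ} {B k : ℕ} {M : Mem}

theorem run_tableCmd {n V : ℕ} {P : ℕ → ℕ} (hP : HasPowers k M) (hB : 0 < B)
    (h1 : M.var 1 = n) (ha6 : M.arr 6 = P) (hV : ∀ u, ∀ S < 2 ^ k, O u S + P S ≤ V)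
    (hVB : (n + 1) * V < 2 ^ B) :
    Run O B tableCmd M ((n + 1) * ((2 ^ k + 1) * ((2 ^ k + 1) * ((k + 1) * 1200)))) fun M' =>
      M'.var 13 = n - 1 ∧ IsTable k (n - 1) (fun u S => O u S + P S)
        (tab k (M'.arr 7)) (tab k (M'.arr 8)) := by
  have hV0 : V ≤ (n + 1) * V := Nat.le_mul_of_pos_left _ (by omega)
  apply Run.of_le
  · apply Run.seq
    refine (Run.loop (n := 2 ^ k) (N := 30) (fun i M' => ∀ T < i, M'.arr 7 T = O 0 T + P T)
      (by decide) rfl rfl hP.var_three (by simp) ?_).mono le_rfl fun M₁ hB₁ hA₁ hrow => ?_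
    · intro T hT M' _ hA hx hI
      have a6 : M'.arr 6 = P := (hA.2 6 rfl).trans ha6
      have hev : (Expr.query 0 (.var 5) + .cell 6 (.var 5)).eval O M' = O 0 T + P T := by
        simp [hx, a6]
      apply Run.of_le
      · apply Run.write
        · rw [hev]; exact (hV 0 T hT).trans_lt (by omega)
        intro T' hT'
        simp only [Mem.setVar_arr, Mem.setCell_arr, true_and, hev]
        simp only [Expr.eval, hx]
        split_ifs with h
        · rw [h]
        · exact hI T' (by omega)
      · simp
    have v1 : M₁.var 1 = n := (hA₁.1 1 rfl).trans h1
    have hP₁ := hP.of_agree hA₁ rfl rfl rfl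
    apply Run.seq
    apply Run.assign
    · have := hB₁.1 1
      simp; omega
    refine (Run.loop (n := n - 1) (N := (2 ^ k + 1) * ((2 ^ k + 1) * ((k + 1) * 1117))) (fun i M' =>
      IsTable k i (fun u S => O u S + P S) (tab k (M'.arr 7)) (tab k (M'.arr 8)))
      (by decide) rfl rfl (by simp [v1]) ?_ ?_).mono le_rfl fun M₂ _ hA₂ h => ⟨?_, h⟩
    · exact ⟨fun T hT => by simpa [tab] using hrow T hT, fun u hu => absurd hu (Nat.not_lt_zero u)⟩
    · intro u hu M₂ _ hA₂ hx₂ hI₂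
      refine (Run.loop (n := 2 ^ k) (N := (2 ^ k + 1) * ((k + 1) * 1100)) (fun i M' =>
        IsTable k u (fun u S => O u S + P S) (tab k (M'.arr 7)) (tab k (M'.arr 8)) ∧
        ∀ T < i, IsBest k (tab k (M'.arr 7) u) (fun S => O (u + 1) S + P S) T (2 ^ k)
          (tab k (M'.arr 7) (u + 1) T) (tab k (M'.arr 8) (u + 1) T))
        (by decide) rfl rfl ((hA₂.1 3 rfl).trans hP₁.var_three) (by simpa using hI₂) ?_).mono
        ?_ fun M₃ _ hA₃ h => ?_
      · rintro T hT M₃ - hA₃ hx₃ ⟨hI₃, hI₃'⟩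
        have hP₃ : HasPowers k M₃ := by
          refine HasPowers.of_agree ?_ hA₃ rfl rfl rfl
          refine HasPowers.of_agree ?_ hA₂ rfl rfl rfl
          exact ⟨by simpa using hP₁.var_zero, by simpa using hP₁.var_three,
            by simpa using hP₁.arr_five⟩
        have v6 : M₃.var 6 = u := (hA₃.1 6 rfl).trans hx₂
        have a6 : M₃.arr 6 = P :=
          (hA₃.2 6 rfl).trans ((hA₂.2 6 rfl).trans ((hA₁.2 6 rfl).trans ha6))
        refine (run_entryCmd hP₃ hB hT hx₃ v6 a6 rfl fun X hX S hS => ?_).mono le_rfl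
          fun M₄ _ hA₄ ⟨d, c, hbest, h7, h8⟩ => ?_
        · have hle := hI₃.le_mul hV le_rfl hX
          have hle' : (u + 1) * V + V ≤ (n + 1) * V := by
            rw [← Nat.succ_mul]
            exact Nat.mul_le_mul_right _ (by omega)
          have := hV (u + 1) S hS
          simp only [tab] at hle
          omega
        · simp only [Mem.setVar_arr, h7, h8]
          have hlow : ∀ (a : ℕ → ℕ) (v : ℕ), ∀ j ≤ u, ∀ X < 2 ^ k, tab k a j X =
              tab k (Function.update a ((u + 1) * 2 ^ k + T) v) j X := fun a v j hj X hX => by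
            rw [tab_update hT hX, if_neg (by omega)]
          refine ⟨hI₃.congr (hlow _ d) (hlow _ c), fun T' hT' => ?_⟩
          have hTk : T' < 2 ^ k := by omega
          rw [tab_update hT hTk, tab_update hT hTk]
          by_cases hTT : T' = T
          · subst hTT
            simp only [and_true, if_true]
            exact hbest.congr hT fun X hX => hlow _ d u le_rfl X hX
          · rw [if_neg (by omega), if_neg (by omega)]
            exact (hI₃' T' (by omega)).congr hTk fun X hX => hlow _ d u le_rfl X hX
      · refine Nat.mul_le_mul_left _ ?_
        have : 1 ≤ (2 ^ k + 1) * (k + 1) := Nat.mul_pos (Nat.succ_pos _) (Nat.succ_pos _)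
        rw [← mul_assoc, ← mul_assoc]
        omega
      · simp only [Mem.setVar_arr]
        refine ⟨h.1.zero, fun j hj T hT => ?_⟩
        rcases Nat.lt_or_eq_of_le (Nat.lt_succ_iff.1 hj) with hlt | rfl
        · exact h.1.succ j hlt T hT
        · exact h.2 T hT
    · rw [hA₂.1 13 rfl]
      simp [v1]
  · have h1 : 1 ≤ 2 ^ k := Nat.one_le_two_pow
    set F := 2 ^ k + 1 with hF
    have h2 : F * 1 ≤ F * (F * (k + 1)) :=
      Nat.mul_le_mul_left _ (Nat.mul_pos (by omega) (by omega))
    have h3 : (n - 1 + 1) * (F * (F * ((k + 1) * 1117)) + 17) ≤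
        (n + 1) * (F * (F * ((k + 1) * 1117)) + 17) := Nat.mul_le_mul_right _ (by omega)
    have h4 : F * (F * (k + 1)) ≤ (n + 1) * (F * (F * (k + 1))) :=
      Nat.le_mul_of_pos_left _ (by omega)
    have e1 : (n + 1) * (F * (F * ((k + 1) * 1117)) + 17) =
      1117 * ((n + 1) * (F * (F * (k + 1)))) + 17 * (n + 1) := by ring
    have e2 : (n + 1) * (F * (F * ((k + 1) * 1200))) =
      1200 * ((n + 1) * (F * (F * (k + 1)))) := by ring
    have h5 : (n + 1) * 1 ≤ (n + 1) * (F * (F * (k + 1))) :=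
      Nat.mul_le_mul_left _ (by omega)
    simp
    omega

/-- The address expression is arbitrary, so that the same statement serves the rows of the users `N,
…, 1` and the final row of user `0`. -/
theorem run_loop_write_bits {x b : ℕ} {e : Expr} (hP : HasPowers k M) (hB : 0 < B)
    (hx8 : x ≠ 8)
    (he : ∀ M', Agree (Cmd.loop 8 0 (.write 4 e (bitExpr x (.var 8)))) M M' →
      e.eval O M' = b + M'.var 8) :
    Run O B (.loop 8 0 (.write 4 e (bitExpr x (.var 8)))) M ((k + 1) * (e.units + 50)) fun M' =>
      ∀ j, M'.arr 4 j = if b ≤ j ∧ j < b + k then M.var x / 2 ^ (j - b) % 2 else M.arr 4 j := by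
  have h2 : 1 < 2 ^ B := Nat.one_lt_two_pow (by omega)
  refine (Run.loop (n := k) (N := e.units + 30) (fun i M' => ∀ j, M'.arr 4 j =
    if b ≤ j ∧ j < b + i then M.var x / 2 ^ (j - b) % 2 else M.arr 4 j)
    (by decide) rfl rfl hP.var_zero (by simp +contextual [Nat.not_lt.2]) ?_).of_le
    (Nat.mul_le_mul_left _ (by omega))
  intro i hi M' _ hA hx hI
  have hev : (bitExpr x (.var 8)).eval O M' = M.var x / 2 ^ i % 2 := by
    rw [eval_bitExpr (s := i), hA.1 x (by simp [Cmd.loop, Cmd.setsVar, hx8])]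
    rw [hA.2 5 rfl, Expr.eval, hx]
    exact hP.arr_five i hi
  apply Run.of_le
  · apply Run.write
    · rw [hev]; omega
    intro j
    simp only [Mem.setVar_arr, Mem.setCell_arr, true_and, hev, he M' hA, hx, hI j]
    by_cases h : j = b + i
    · subst h
      simp
    · rw [if_neg h]
      refine if_congr ?_ rfl rfl
      omega
  · simp [bitExpr]
    omega

theorem run_outputCmd {N : ℕ} {C : ℕ → ℕ → ℕ} (hP : HasPowers k M) (hB : 0 < B)
    (h13 : M.var 13 = N) (ha8 : tab k (M.arr 8) = C) :
    Run O B outputCmd M ((N + 2) * ((k + 1) * 500)) fun M' =>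
      ∀ u ≤ N, ∀ s < k, M'.arr 4 (u * k + s) = part k N C u / 2 ^ s % 2 := by
  apply Run.of_le
  · apply Run.seq
    apply Run.of_bounded
    intro hB₀
    apply Run.assign
    · have := hB₀.1 3
      simp; omega
    apply Run.seq
    refine (Run.loop (n := N) (N := (k + 1) * 300) (fun i M' => M'.var 5 = remaining k N C i ∧
      ∀ j < i, ∀ s < k, M'.arr 4 ((N - j) * k + s) =
        C (N - j) (remaining k N C j) / 2 ^ s % 2)
      (by decide) rfl rfl (by simpa) (by simp [hP.var_three, remaining]) ?_).mono le_rfl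
      fun M₁ hB₁ hA₁ h => ?_
    · rintro i hi M₁ hB₁ hA₁ hx₁ ⟨v5, hrows⟩
      have v13 : M₁.var 13 = N := (hA₁.1 13 rfl).trans h13
      have v3 : M₁.var 3 = 2 ^ k := (hA₁.1 3 rfl).trans hP.var_three
      have v0 : M₁.var 0 = k := (hA₁.1 0 rfl).trans hP.var_zero
      have a8 : M₁.arr 8 = M.arr 8 := hA₁.2 8 rfl
      have hev : (Expr.cell 8 ((.var 13 - .var 6) * .var 3 + .var 5)).eval O M₁ =
          C (N - i) (remaining k N C i) := by
        simp [v13, v3, v5, hx₁, a8, ← ha8, tab]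
      apply Run.of_le
      · apply Run.seq
        apply Run.assign
        · simpa using hB₁.2 8 _
        rw [hev]
        apply Run.seq
        refine (run_loop_write_bits (b := (N - i) * k) ⟨by simpa using v0, by simpa using v3,
          fun s hs => ?_⟩ hB (by decide) fun M₂ hA₂ => ?_).mono le_rfl fun M₂ hB₂ hA₂ h₂ => ?_
        · simp only [Mem.setVar_arr]
          rw [hA₁.2 5 rfl]
          exact hP.arr_five s hs
        · have w13 : M₂.var 13 = N := (hA₂.1 13 rfl).trans v13
          have w6 : M₂.var 6 = i := (hA₂.1 6 rfl).trans hx₁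
          have w0 : M₂.var 0 = k := (hA₂.1 0 rfl).trans v0
          simp [w13, w6, w0]
        have w5 : M₂.var 5 = remaining k N C i := (hA₂.1 5 rfl).trans v5
        have w12 : M₂.var 12 = C (N - i) (remaining k N C i) := hA₂.1 12 rfl
        apply Run.assign
        · have := hB₂.1 5
          simp; omega
        refine ⟨by simp [w5, w12, remaining], fun j hj s hs => ?_⟩
        simp only [Mem.setVar_arr, h₂]
        rcases Nat.lt_or_eq_of_le (Nat.lt_succ_iff.1 hj) with hlt | rfl
        -- Rows are written from the last user downwards, so earlier rows lie strictly above the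
        -- current one and are untouched.
        · have hmul : (N - i) * k + k ≤ (N - j) * k := by
            rw [← Nat.succ_mul]
            exact Nat.mul_le_mul_right _ (by omega)
          rw [if_neg (by omega)]
          exact hrows j hlt s hs
        · rw [if_pos (by omega), Nat.add_sub_cancel_left]
          simp
      · simp
        omega
    · have hP₁ : HasPowers k M₁ := by
        refine HasPowers.of_agree ?_ hA₁ rfl rfl rfl
        exact ⟨by simpa using hP.var_zero, by simpa using hP.var_three, by simpa using hP.arr_five⟩
      refine (run_loop_write_bits (b := 0) hP₁ hB (by decide) (by simp)).mono le_rfl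
        fun M₂ _ _ h₂ u hu s hs => ?_
      rw [h₂]
      unfold part
      split_ifs with hc hu0 hu0
      · simp [hu0, h.1]
      · have : 1 * k ≤ u * k := Nat.mul_le_mul_right _ (by omega)
        omega
      · subst hu0
        omega
      · have := h.2 (N - u) (by omega) s hs
        rwa [Nat.sub_sub_self hu] at this
  · simp
    have e1 : (N + 1) * ((k + 1) * 300 + 17) = 300 * ((N + 1) * (k + 1)) + 17 * (N + 1) := by ring
    have e2 : (N + 2) * ((k + 1) * 500) = 500 * ((N + 1) * (k + 1)) + 500 * (k + 1) := by ring
    have e3 : (N + 1) * 1 ≤ (N + 1) * (k + 1) := Nat.mul_le_mul_left _ (by omega)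
    omega

end Specs

/-- Compute the instance of Valued WSP(=,≠). -/
def reduceCmd : Cmd :=
  .loop 8 2 (.seq (.write 4 (.var 8) (.cell 0 (.var 8)))
    (.seq (.write 5 (.var 8) (.cell 1 (.var 8)))
    (.seq (.write 6 (.var 8) (.cell 2 (.var 8)))
      (.write 7 (.var 8) (.cell 3 (.var 8 * (.var 1 + 1) + 1))))))

/-! ### Bit lengths and charges of an encoded instance -/

namespace ValuedAPEP

variable {n k : ℕ} (I : ValuedAPEP (Fin n) (Fin k))

theorem le_size : 1 + n + k + I.m ≤ I.size := by
  unfold size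
  omega

theorem f_lt_two_pow_size (c : Fin I.m) {z : ℕ} (hz : z < n + 1) :
    (I.con c).f (z : ℤ) < 2 ^ I.size := by
  refine Nat.size_le.1 ?_
  have h₁ := Finset.single_le_sum
    (f := fun z : Fin (n + 1) => ((I.con c).f ((z : ℕ) : ℤ)).size) (fun _ _ => Nat.zero_le _)
    (Finset.mem_univ ⟨z, hz⟩)
  have h₂ := Finset.single_le_sum
    (f := fun c => ∑ z : Fin (n + 1), ((I.con c).f ((z : ℕ) : ℤ)).size) (fun _ _ => Nat.zero_le _)
    (Finset.mem_univ c)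
  simp only at h₁
  unfold size
  omega

/-- By monotonicity each answer is at most `ω(u, R)`, whose length is part of the size. -/
theorem oracle_lt (u t : ℕ) : I.auth.oracle u t < 2 ^ I.size := by
  unfold AuthWeight.oracle
  split_ifs with h
  · refine (I.auth.mono _ _ _ (Finset.subset_univ _)).trans_lt (Nat.size_le.1 ?_)
    have := Finset.single_le_sum (f := fun u => (I.auth.ω u Finset.univ).size)
      (fun _ _ => Nat.zero_le _) (Finset.mem_univ ⟨u, h⟩)
    unfold size
    omega
  · exact Nat.two_pow_pos _

theorem encode_bounded : I.encode.Bounded I.size := by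
  have hs := I.le_size
  have hlt : I.size < 2 ^ I.size := Nat.lt_two_pow_self
  refine ⟨fun x => ?_, fun a i => ?_⟩
  · simp only [encode]
    split <;> omega
  · simp only [encode]
    split <;> beta_reduce
    · split_ifs with h
      · have : (I.con ⟨i, h⟩).duty.code ≤ 1 := by cases (I.con ⟨i, h⟩).duty <;> simp [Duty.code]
        omega
      · omega
    · split_ifs with h
      · have := (I.con ⟨i, h⟩).fst.2
        omega
      · omega
    · split_ifs with h
      · have := (I.con ⟨i, h⟩).snd.2
        omega
      · omega
    · split_ifs with h
      · exact I.f_lt_two_pow_size _ (Nat.mod_lt _ (by omega))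
      · omega
    · omega

theorem encode_arr_zero (c : Fin I.m) : I.encode.arr 0 c = (I.con c).duty.code := by
  simp [encode]

theorem encode_arr_one (c : Fin I.m) : I.encode.arr 1 c = (I.con c).fst := by
  simp [encode]

theorem encode_arr_two (c : Fin I.m) : I.encode.arr 2 c = (I.con c).snd := by
  simp [encode]

/-- For `n = 0` the rows of the tables have length one, and `f_c(1)` is not stored. -/
theorem encode_arr_three (hn : n ≠ 0) (c : Fin I.m) :
    I.encode.arr 3 (c * (n + 1) + 1) = (I.con c).f 1 := by
  have hd : ((c : ℕ) * (n + 1) + 1) / (n + 1) = c := by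
    rw [Nat.mul_comm, Nat.mul_add_div (by omega), Nat.div_eq_of_lt (by omega), add_zero]
  have hm : ((c : ℕ) * (n + 1) + 1) % (n + 1) = 1 := by
    rw [Nat.mul_comm, Nat.mul_add_mod, Nat.mod_eq_of_lt (by omega)]
  simp only [encode, hd, hm, c.2, dif_pos, Nat.cast_one]

/-- With the codes 0 for SoD and 1 for BoD, the test whether code plus second bit equals 1 asks for
`c.snd ∈ S` in the first case and `c.snd ∉ S` in the second. -/
theorem chargeValue_encode (hn : n ≠ 0) (c : Fin I.m) (S : ℕ) :
    chargeValue I.encode n c S = (I.con c).charge (bits k S) := by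
  rw [chargeValue, encode_arr_zero, encode_arr_one, encode_arr_two, encode_arr_three I hn,
    UConstraint.charge]
  simp only [mem_bits]
  have h1 := Nat.mod_two_eq_zero_or_one (S / 2 ^ ((I.con c).fst : ℕ))
  have h2 := Nat.mod_two_eq_zero_or_one (S / 2 ^ ((I.con c).snd : ℕ))
  cases (I.con c).duty <;> rcases h1 with h1 | h1 <;> rcases h2 with h2 | h2 <;>
    simp [h1, h2, Duty.code]

theorem chargeValue_encode_le (c S : ℕ) : chargeValue I.encode n c S ≤ 2 ^ I.size := by
  have h := I.encode_bounded.2 3 (c * (n + 1) + 1)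
  have h1 : S / 2 ^ I.encode.arr 1 c % 2 *
      (if S / 2 ^ I.encode.arr 2 c % 2 + I.encode.arr 0 c = 1 then 1 else 0) ≤ 1 := by
    have := Nat.mod_lt (S / 2 ^ I.encode.arr 1 c) (by norm_num : 0 < 2)
    split_ifs <;> omega
  exact (Nat.mul_le_mul h.le h1).trans (by simp)

theorem sum_chargeValue_encode_le (S : ℕ) :
    ∑ c ∈ Finset.range I.m, chargeValue I.encode n c S ≤ I.m * 2 ^ I.size := by
  simpa using Finset.sum_le_card_nsmul (Finset.range I.m) _ _ fun c _ =>
    I.chargeValue_encode_le c S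

theorem oracle_add_sum_eq {n : ℕ} (I : ValuedAPEP (Fin (n + 1)) (Fin k)) (u : Fin (n + 1))
    (S : ℕ) : I.auth.oracle u S + ∑ c ∈ Finset.range I.m, chargeValue I.encode (n + 1) c S =
      I.userCost u (bits k S) := by
  rw [userCost, Finset.sum_range]
  congr 1
  · simp only [AuthWeight.oracle, bits, u.2, dif_pos]
  · exact Finset.sum_congr rfl fun c _ => I.chargeValue_encode (by omega) c S

end ValuedAPEP

/-! ### Correctness and running time of the whole program -/

theorem IsTable.congr_left {k N : ℕ} {Φ Φ' D C : ℕ → ℕ → ℕ} (h : IsTable k N Φ D C)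
    (hΦ : ∀ u, ∀ T < 2 ^ k, Φ u T = Φ' u T) : IsTable k N Φ' D C where
  zero T hT := by rw [h.zero T hT, hΦ 0 T hT]
  succ u hu T hT := by
    obtain ⟨hc, hd, hmin⟩ := h.succ u hu T hT
    exact ⟨hc, by rw [hd, hΦ _ _ hc.1], fun S hS hs => by
      rw [← hΦ _ _ hS]; exact hmin S hS hs⟩

theorem run_solveCmd {n k : ℕ} (I : ValuedAPEP (Fin n) (Fin k)) :
    Run I.auth.oracle (3 * I.size) solveCmd I.encode (7900 * 4 ^ k * I.size ^ 2) fun M =>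
      ∃ D C, IsTable k (n - 1) (fun u S => I.auth.oracle u S +
          ∑ c ∈ Finset.range I.m, chargeValue I.encode n c S) D C ∧
        ∀ u ≤ n - 1, ∀ s < k, M.arr 4 (u * k + s) = part k (n - 1) C u / 2 ^ s % 2 := by
  have hs := I.le_size
  have hlt : I.size < 2 ^ I.size := Nat.lt_two_pow_self
  have hpow : 2 ^ (3 * I.size) = 2 ^ I.size * (2 ^ I.size * 2 ^ I.size) := by
    rw [← pow_add, ← pow_add]
    congr 1
    omega
  -- A cost of one user is at most `(m + 1) 2^|I|`, and a table entry adds up at most `n + 1` of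
  -- them; three factors `2^|I|` therefore suffice, whence the bit bound `3|I|`.
  have hV : (n + 1) * ((I.m + 1) * 2 ^ I.size) < 2 ^ (3 * I.size) := by
    rw [hpow]
    refine Nat.mul_lt_mul_of_lt_of_le (by omega) (Nat.mul_le_mul_right _ (by omega)) ?_
    positivity
  have hV' : (I.m + 1) * 2 ^ I.size ≤ (n + 1) * ((I.m + 1) * 2 ^ I.size) :=
    Nat.le_mul_of_pos_left _ (by omega)
  have hB : 0 < 3 * I.size := by omega
  apply Run.of_le
  · apply Run.seq
    refine (run_powersCmd (k := k) rfl (Nat.pow_lt_pow_right (by norm_num) (by omega))).mono le_rfl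
      fun M₁ _ hA₁ hP₁ => ?_
    have hcv : chargeValue M₁ = chargeValue I.encode := by
      unfold chargeValue
      rw [hA₁.2 0 rfl, hA₁.2 1 rfl, hA₁.2 2 rfl, hA₁.2 3 rfl]
    apply Run.seq
    refine (run_chargesCmd (n := n) (m := I.m) hP₁ (hA₁.1 1 rfl) (hA₁.1 2 rfl) (fun c hc => ?_)
      (fun c hc => ?_) fun S _ => ?_).mono le_rfl fun M₂ _ hA₂ h₂ => ?_
    · rw [hA₁.2 1 rfl, I.encode_arr_one ⟨c, hc⟩]
      exact Fin.is_lt _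
    · rw [hA₁.2 2 rfl, I.encode_arr_two ⟨c, hc⟩]
      exact Fin.is_lt _
    · rw [hcv]
      have := I.sum_chargeValue_encode_le S
      have := Nat.mul_le_mul_right (2 ^ I.size) (Nat.le_succ I.m)
      simp only [Nat.succ_eq_add_one] at this
      omega
    rw [hcv] at h₂
    apply Run.seq
    refine (run_tableCmd (n := n) (V := (I.m + 1) * 2 ^ I.size) (hP₁.of_agree hA₂ rfl rfl rfl) hB
      ((hA₂.1 1 rfl).trans (hA₁.1 1 rfl)) rfl (fun u S hS => ?_) hV).mono le_rfl
      fun M₃ _ hA₃ h₃ => ?_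
    · rw [h₂ S hS]
      have := I.sum_chargeValue_encode_le S
      have := I.oracle_lt u S
      rw [add_mul]
      omega
    refine (run_outputCmd ((hP₁.of_agree hA₂ rfl rfl rfl).of_agree hA₃ rfl rfl rfl) hB h₃.1
      rfl).mono le_rfl fun M₄ _ _ h₄ => ?_
    exact ⟨_, _, h₃.2.congr_left fun u T hT => by rw [h₂ T hT], h₄⟩
  · have hF : 1 ≤ 2 ^ k := Nat.one_le_two_pow
    have h4 : 4 ^ k = 2 ^ k * 2 ^ k := by rw [← mul_pow]; rfl
    rw [h4]
    generalize 2 ^ k = F at *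
    generalize I.size = s at *
    have hk1 : k + 1 ≤ s := by omega
    have hm1 : I.m + 1 ≤ s := by omega
    have hn1 : n + 1 ≤ s := by omega
    have hn2 : n - 1 + 2 ≤ 2 * s := by omega
    have hF2 : F + 1 ≤ 2 * F := by omega
    -- The dominant term has two factors `F + 1`, for the loops over `T` and over `S`; they give `4
    -- ^ k`.
    calc (k + 1) * 100 + ((F + 1) * ((I.m + 1) * 1000) +
          ((n + 1) * ((F + 1) * ((F + 1) * ((k + 1) * 1200))) + (n - 1 + 2) * ((k + 1) * 500)))
        ≤ s * 100 + (2 * F * (s * 1000) +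
          (s * (2 * F * (2 * F * (s * 1200))) + 2 * s * (s * 500))) := by gcongr
      _ = 100 * s * 1 * 1 * 1 + 2000 * s * F * 1 * 1 + 4800 * s * F * F * s +
          1000 * s * 1 * 1 * s := by ring
      _ ≤ 100 * s * F * F * s + 2000 * s * F * F * s + 4800 * s * F * F * s +
          1000 * s * F * F * s := by gcongr <;> omega
      _ = 7900 * (F * F) * s ^ 2 := by ring

theorem isOptimalSolution_readRelation {n k : ℕ} (I : ValuedAPEP (Fin n) (Fin k))
    (hI : ∃ A : Finset (Fin n × Fin k), Complete A) {D C : ℕ → ℕ → ℕ} {a : ℕ → ℕ}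
    (h : IsTable k (n - 1) (fun u S => I.auth.oracle u S +
      ∑ c ∈ Finset.range I.m, chargeValue I.encode n c S) D C)
    (ha : ∀ u ≤ n - 1, ∀ s < k, a (u * k + s) = part k (n - 1) C u / 2 ^ s % 2) :
    I.IsOptimalSolution (readRelation n k a) := by
  rcases n with _ | n
  -- Without users, a complete relation exists only if there are no resources, and all relations are
  -- empty.
  · obtain ⟨A, hA⟩ := hI
    refine ⟨fun r => (hA r).choose.elim0, fun A' _ => le_of_eq (congrArg _ ?_)⟩
    ext p
    exact p.1.elim0
  · refine I.isOptimalSolution_of_isTable h (fun u T _ => I.oracle_add_sum_eq u T) _ fun u r => ?_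
    simp only [readRelation, Finset.mem_filter, Finset.mem_univ, true_and]
    rw [ha u (by omega) r r.2, mem_bits]
    rfl

/-! ### The time bound as a function of the parameter -/

theorem two_rpow_mul_logb (k : ℕ) :
    (2 : ℝ) ^ ((k : ℝ) * Real.logb 2 k) = ((k ^ k : ℕ) : ℝ) := by
  rcases Nat.eq_zero_or_pos k with rfl | hk
  -- For `k = 0` both sides are 1, because `0 ^ 0 = 1`.
  · simp
  · rw [mul_comm, Real.rpow_mul (by norm_num), Real.rpow_logb (by norm_num) (by norm_num)
      (by exact_mod_cast hk), Real.rpow_natCast]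
    norm_cast

theorem four_pow_le (k : ℕ) : 4 ^ k ≤ 256 * k ^ k := by
  rcases Nat.lt_or_ge k 4 with h | h
  · interval_cases k <;> norm_num
  · exact (Nat.pow_le_pow_left h k).trans (Nat.le_mul_of_pos_left _ (by norm_num))

theorem solvableInTime_pow_self : SolvableInTime fun k => ((k ^ k : ℕ) : ℝ) := by
  refine ⟨solveCmd, 7900 * 256 * 16, 4, fun n k I hI => ?_⟩
  have hs := I.le_size
  have hle : 2 ^ I.size ≤ 2 ^ (3 * I.size) := Nat.pow_le_pow_right (by norm_num) (by omega)
  obtain ⟨M, t, he, -, ht, D, C, h, ha⟩ := run_solveCmd I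
    (fun u T => (I.oracle_lt u T).trans_le hle)
    ⟨fun x => (I.encode_bounded.1 x).trans_le hle, fun a i => (I.encode_bounded.2 a i).trans_le hle⟩
  refine ⟨M, t, he, isOptimalSolution_readRelation I hI h ha, ?_⟩
  -- With `B = 3|I|` a unit is worth `(3|I| + 1)² ≤ 16|I|²`; this gives the factor 16 and two of the
  -- four powers of the size.
  have hN : t ≤ 7900 * 256 * 16 * k ^ k * I.size ^ 4 := calc
    t ≤ 7900 * 4 ^ k * I.size ^ 2 * (3 * I.size + 1) ^ 2 := ht
    _ ≤ 7900 * (256 * k ^ k) * I.size ^ 2 * (4 * I.size) ^ 2 := by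
      gcongr
      · exact four_pow_le k
      · omega
    _ = 7900 * 256 * 16 * k ^ k * I.size ^ 4 := by ring
  beta_reduce
  exact_mod_cast hN

theorem isFPT : IsFPT := by
  refine ⟨fun k => k ^ k, ?_, solvableInTime_pow_self⟩
  refine (Primrec.nat_iff.2
    ((Nat.Primrec.pow.comp (Nat.Primrec.pair .id .id)).of_eq fun k => ?_)).to_comp
  simp

/-! ### The reduction to Valued WSP in polynomial time -/

theorem achievableInTime_toWSP :
    AchievableInTime (fun I M => I.toWSP.StoredIn M) (fun _ => 1) := by
  refine ⟨reduceCmd, 100 * 4, 3, fun n k I hI => ?_⟩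
  have hs := I.le_size
  -- A constraint names a resource, and completeness supplies a user for it; so `f_c(1)` is in the
  -- table whenever it is read.
  have hn : ∀ c : Fin I.m, n ≠ 0 := by
    rintro c rfl
    obtain ⟨A, hA⟩ := hI
    exact (hA (I.con c).fst).choose.elim0
  -- The program only copies input cells and counts up to `m`, so the bit bound of the input is
  -- enough.
  have hrun : Run I.auth.oracle I.size reduceCmd I.encode ((I.m + 1) * 100)
      fun M => ∀ c : Fin I.m, (c : ℕ) < I.m → M.arr 4 c = (I.con c).duty.code ∧
        M.arr 5 c = (I.con c).fst ∧ M.arr 6 c = (I.con c).snd ∧ M.arr 7 c = (I.con c).f 1 := by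
    refine Run.loop (n := I.m) (N := 83) (fun i M => ∀ c : Fin I.m, (c : ℕ) < i →
      M.arr 4 c = (I.con c).duty.code ∧ M.arr 5 c = (I.con c).fst ∧
      M.arr 6 c = (I.con c).snd ∧ M.arr 7 c = (I.con c).f 1)
      (by decide) rfl rfl rfl (by simp) ?_
    intro i hi M hB hA hx hI
    have e0 := congrFun (hA.2 0 rfl) i
    have e1 := congrFun (hA.2 1 rfl) i
    have e2 := congrFun (hA.2 2 rfl) i
    have e3 := congrFun (hA.2 3 rfl) (i * (n + 1) + 1)
    have v1 : M.var 1 = n := hA.1 1 rfl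
    rw [I.encode_arr_zero ⟨i, hi⟩] at e0
    rw [I.encode_arr_one ⟨i, hi⟩] at e1
    rw [I.encode_arr_two ⟨i, hi⟩] at e2
    rw [I.encode_arr_three (hn ⟨i, hi⟩) ⟨i, hi⟩] at e3
    apply Run.of_le
    · apply Run.seq
      apply Run.write
      · simpa using hB.2 0 _
      apply Run.seq
      apply Run.write
      · simpa using hB.2 1 _
      apply Run.seq
      apply Run.write
      · simpa using hB.2 2 _
      apply Run.write
      · simpa using hB.2 3 _
      intro c hc
      by_cases hci : (c : ℕ) = i
      · obtain rfl : c = ⟨i, hi⟩ := Fin.ext hci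
        simp [hx, v1, e0, e1, e2, e3]
      · simpa [hx, hci] using hI c (by omega)
    · simp
  obtain ⟨M, t, he, -, ht, h⟩ := hrun (fun u T => I.oracle_lt u T) I.encode_bounded
  have hA := he.agree
  refine ⟨M, t, he, ⟨hA.1 0 rfl, hA.1 1 rfl, hA.1 2 rfl, fun c => h c c.2⟩, ?_⟩
  have hN : t ≤ 100 * 4 * I.size ^ 3 := calc
    t ≤ (I.m + 1) * 100 * (I.size + 1) ^ 2 := ht
    _ ≤ I.size * 100 * (2 * I.size) ^ 2 := by gcongr <;> omega
    _ = 100 * 4 * I.size ^ 3 := by ring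
  rw [mul_one]
  exact_mod_cast hN

end APEP

theorem mainTheorem4 :
    APEP.IsFPT ∧
    APEP.SolvableInTime (fun k => (2 : ℝ) ^ ((k : ℝ) * Real.logb 2 k)) ∧
    (∀ (U R : Type*) [Fintype U] [Fintype R] [DecidableEq U] [DecidableEq R]
      (I : APEP.ValuedAPEP U R),
      -- optimal solutions with exactly one user for each resource
      ((∃ A : Finset (U × R), APEP.Complete A) →
        ∃ A : Finset (U × R), I.IsOptimalSolution A ∧ ∀ r, (APEP.usersOf A r).card = 1) ∧
      (∀ A : Finset (U × R), I.IsOptimalSolution A →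
        ∃ A' ⊆ A, I.IsOptimalSolution A' ∧ ∀ r, (APEP.usersOf A' r).card = 1) ∧
      -- correctness of the reduction to Valued WSP(=,≠)
      (∀ π : R → U, I.toWSP.weight π = I.weight (APEP.graph π)) ∧
      (∀ π : R → U, I.toWSP.IsOptimalPlan π ↔ I.IsOptimalSolution (APEP.graph π)) ∧
      (∀ (A : Finset (U × R)) (π : R → U), I.IsOptimalSolution A → I.toWSP.IsOptimalPlan π →
        I.toWSP.weight π = I.weight A)) ∧
    -- the reduction takes polynomial time
    APEP.AchievableInTime (fun I M => I.toWSP.StoredIn M) (fun _ => 1) := by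
  refine ⟨APEP.isFPT, ?_, fun U R _ _ _ _ I => ⟨fun h => ?_, fun A hA => hA.exists_subset,
    I.toWSP_weight, I.isOptimalPlan_toWSP_iff, fun A π hA hπ => ?_⟩, APEP.achievableInTime_toWSP⟩
  · simp only [APEP.two_rpow_mul_logb]
    exact APEP.solvableInTime_pow_self
  · obtain ⟨A, hA⟩ := I.exists_isOptimalSolution h
    obtain ⟨A', -, h'⟩ := hA.exists_subset
    exact ⟨A', h'⟩
  · have hg := (I.isOptimalPlan_toWSP_iff π).1 hπ
    rw [I.toWSP_weight]
    exact (hg.2 A hA.1).antisymm (hA.2 _ hg.1)
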